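/- Let $F=\mathbb{Q}(x_1,\dots,x_5)$, with $x_1,\dots,x_5$ indeterminates, and regard $\bigotimes^N F^\times$ (the $N$-fold tensor power over $\mathbb{Z}$ of the multiplicative group $F^\times$, with tensors written multiplicatively in each slot) as the space of symbols of weight $N$. *Symbols.* For $a,b,c\in F$ put $I(a;b;c)=1$ if $a=b=c$; $I(a;b;c)=\frac{1}{b-a}$ if $a\ne b=c$; $I(a;b;c)=b-c$ if $a=b\neq c$; and $I(a;b;c)=\frac{b-c}{b-a}$ otherwise (these are the arguments of the logarithms that give the regularised weight one iterated integrals). The symbol of the iterated integral $I(y_0;y_1,\dots,y_N;y_{N+1})$, $y_i\in F$, is obtained by iterating the $(N-1,1)$-part of the coproduct: it is $1$ for $N=0$, and $$\operatorname{Symb} I(y_0;y_1,\dots,y_N;y_{N+1})=\sum_{j=1}^N \operatorname{Symb} I(y_0;y_1,\dots,\widehat{y_j},\dots,y_N;y_{N+1})\otimes I(y_{j-1};y_j;y_{j+1})\in\textstyle\bigotimes^N F^\times .$$ Let $\rho_N=N\Pi_N$, where $\Pi_N$ is the projector annihilating shuffle products; that is, $\rho_1=\mathrm{id}$ and $$\rho_N(a_1\otimes\cdots\otimes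 a_N)=\rho_{N-1}(a_1\otimes\cdots\otimes a_{N-1})\otimes a_N-\rho_{N-1}(a_2\otimes\cdots\otimes a_N)\otimes a_1 .$$ The mod-products symbol is $\operatorname{Symb}^{\mathrm{sh}}=\rho_N\circ\operatorname{Symb}$ in weight $N$. It is extended linearly to formal $\mathbb{Z}$-linear combinations of iterated integrals, and two such combinations $f,g$ of weight $N$ satisfy $f\overset{\mathrm{sh}}{=}g$ if $\operatorname{Symb}^{\mathrm{sh}}f$ and $\operatorname{Symb}^{\mathrm{sh}}g$ agree in $\bigotimes^N F^\times$ modulo $2$-torsion. The Nielsen polylogarithms are $S_{n,p}(z)=(-1)^pI(0;\{1\}^p,\{0\}^n;z)$, where $\{a\}^k$ is the string $a$ repeated $k$ times, and $\operatorname{Li}_5=S_{4,1}$. Write $f(\sum_j\nu_j[z_j])=\sum_j\nu_jf(z_j)$. *Ratios.* Put $$\mathrm{CR}(x_1,x_2,x_3,x_4)=\frac{(x_1-x_3)(x_2-x_4)}{(x_1-x_4)(x_2-x_3)},\qquad R_1(x_1,\dots,x_5)=-\frac{(x_1-x_2)(x_1-x_4)(x_3-x_5)}{(x_1-x_3)(x_1-x_5)(x_2-x_4)},$$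 $$R_2(x_1,\dots,x_5)=-\frac{(x_1-x_2)^2(x_3-x_4)(x_3-x_5)}{(x_1-x_3)(x_1-x_4)(x_2-x_3)(x_2-x_5)},$$ $$R_3(x_1,\dots,x_5)=-\frac{(x_1-x_2)^3(x_1-x_5)(x_3-x_4)^2(x_3-x_5)}{(x_1-x_3)^3(x_1-x_4)(x_2-x_4)(x_2-x_5)^2}.$$ Let $\operatorname{Alt}_5 f(x_1,\dots,x_5)=\sum_{\sigma\in\mathfrak{S}_5}\operatorname{sgn}(\sigma)\,f(x_{\sigma(1)},\dots,x_{\sigma(5)})$. **Theorem.** In $\bigotimes^5\mathbb{Q}(x_1,\dots,x_5)^\times$, modulo $2$-torsion, $$\operatorname{Alt}_5\Big(11\,S_{3,2}\big(\mathrm{CR}(x_1,x_2,x_3,x_4)\big)+\operatorname{Li}_5\big(15[R_1(x_1,\dots,x_5)]-9[R_2(x_1,\dots,x_5)]+[R_3(x_1,\dots,x_5)]\big)\Big)\overset{\mathrm{sh}}{=}0 .$$ -/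

import Mathlib

open scoped TensorProduct

namespace NielsenSymbol

noncomputable section

/-- The tensors in which symbols of weight `N` live: the `N`-th tensor power over `ℤ` of the
multiplicative group of the field `F` (written additively, as a `ℤ`-module). -/
abbrev SymbolSpace (F : Type) [Field F] (N : ℕ) : Type :=
  ⨂[ℤ]^N (Additive Fˣ)

/-- `w ⊗ u`: append one tensor factor on the right. -/
def snoc {F : Type} [Field F] {N : ℕ} (w : SymbolSpace F N) (u : Additive Fˣ) :
    SymbolSpace F (N + 1) :=
  TensorPower.mulEquiv (R := ℤ) (M := Additive Fˣ) (n := N) (m := 1)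
    (w ⊗ₜ[ℤ] PiTensorProduct.tprod ℤ (fun _ : Fin 1 => u))

/-- The (regularised) weight one iterated integral `I(a; b; c)`, as an element of `Fˣ`:
the integral is the logarithm of this element. -/
def weightOne {F : Type} [Field F] [DecidableEq F] (a b c : F) : Additive Fˣ :=
  if hab : a = b then
    if hbc : b = c then 0
    else Additive.ofMul (Units.mk0 (b - c) (sub_ne_zero.2 hbc))
  else
    if hbc : b = c then
      Additive.ofMul (Units.mk0 (1 / (b - a)) (one_div_ne_zero (sub_ne_zero.2 (Ne.symm hab))))
    else
      Additive.ofMul (Units.mk0 ((b - c) / (b - a))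
        (div_ne_zero (sub_ne_zero.2 hbc) (sub_ne_zero.2 (Ne.symm hab))))

/-- The symbol of the weight `N` iterated integral `I(x 0; x 1, …, x N; x (N+1))`, obtained by
iterating the `(N-1, 1)`-part
`∑ⱼ I(x 0; …, x (j-1), x (j+1), …; x (N+1)) ⊗ I(x (j-1); x j; x (j+1))`
of the coproduct. (Below, `j : Fin (N + 1)` stands for the interior index `j + 1`.) -/
def symb {F : Type} [Field F] [DecidableEq F] :
    (N : ℕ) → (Fin (N + 2) → F) → SymbolSpace F N
  | 0, _ => PiTensorProduct.tprod ℤ (fun i : Fin 0 => i.elim0)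
  | N + 1, x => ∑ j : Fin (N + 1),
      snoc (symb N (fun i => x (j.succ.castSucc.succAbove i)))
        (weightOne (x j.castSucc.castSucc) (x j.succ.castSucc) (x j.succ.succ))

/-- The cyclic shift `a₁ ⊗ a₂ ⊗ ⋯ ⊗ a_N ↦ a₂ ⊗ ⋯ ⊗ a_N ⊗ a₁`. -/
def cyclicShift (F : Type) [Field F] (N : ℕ) : SymbolSpace F N →ₗ[ℤ] SymbolSpace F N :=
  (PiTensorProduct.reindex ℤ (fun _ : Fin N => Additive Fˣ) (finRotate N).symm).toLinearMap

/-- `f ⊗ id`, acting by `f` on the first `N` tensor factors out of `N + 1`. -/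
def onInit {F : Type} [Field F] {N : ℕ} (f : SymbolSpace F N →ₗ[ℤ] SymbolSpace F N) :
    SymbolSpace F (N + 1) →ₗ[ℤ] SymbolSpace F (N + 1) :=
  (TensorPower.mulEquiv (R := ℤ) (M := Additive Fˣ) (n := N) (m := 1)).toLinearMap ∘ₗ
    f.rTensor (⨂[ℤ]^1 (Additive Fˣ)) ∘ₗ
      (TensorPower.mulEquiv (R := ℤ) (M := Additive Fˣ) (n := N) (m := 1)).symm.toLinearMap

/-- The operator `ρ_N = N Π_N`, where `Π_N` is the projector that annihilates shuffle products:
`ρ_1 = id` and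
`ρ_N (a₁ ⊗ ⋯ ⊗ a_N) = ρ_{N-1} (a₁ ⊗ ⋯ ⊗ a_{N-1}) ⊗ a_N - ρ_{N-1} (a₂ ⊗ ⋯ ⊗ a_N) ⊗ a₁`. -/
def rho (F : Type) [Field F] : (N : ℕ) → SymbolSpace F N →ₗ[ℤ] SymbolSpace F N
  | 0 => 0
  | 1 => LinearMap.id
  | N + 2 => onInit (rho F (N + 1)) ∘ₗ (LinearMap.id - cyclicShift F (N + 2))

/-- The mod-products symbol of the iterated integral `I(x 0; x 1, …, x N; x (N+1))`. -/
def modProductsSymb {F : Type} [Field F] [DecidableEq F] (N : ℕ) (x : Fin (N + 2) → F) :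
    SymbolSpace F N :=
  rho F N (symb N x)

/-- The mod-products symbol of the Nielsen polylogarithm
`S_{n,p}(z) = (-1)^p I(0; 1, …, 1, 0, …, 0; z)`, with `p` ones followed by `n` zeros. -/
def nielsenSymb {F : Type} [Field F] [DecidableEq F] (n p : ℕ) (z : F) : SymbolSpace F (n + p) :=
  (-1 : ℤ) ^ p • modProductsSymb (n + p) (fun i : Fin (n + p + 2) =>
    if i.val = 0 then 0 else if i.val ≤ p then 1 else if i.val ≤ n + p then 0 else z)

/-- The mod-products symbol of the classical polylogarithm `Li_5 = S_{4,1}`. -/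
def li5Symb {F : Type} [Field F] [DecidableEq F] (z : F) : SymbolSpace F 5 :=
  nielsenSymb 4 1 z

/-- `Li_5` extended by linearity to formal linear combinations `∑ ν_j [z_j]`. -/
def li5SymbLinear {F : Type} [Field F] [DecidableEq F] : (F →₀ ℤ) →ₗ[ℤ] SymbolSpace F 5 :=
  Finsupp.linearCombination ℤ (li5Symb (F := F))

/-- The formal generator `[z]`. -/
def bracket {F : Type} [Field F] (z : F) : F →₀ ℤ := Finsupp.single z 1

/-- The classical cross-ratio. -/
def crossRatio {F : Type} [Field F] (x₁ x₂ x₃ x₄ : F) : F :=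
  ((x₁ - x₃) * (x₂ - x₄)) / ((x₁ - x₄) * (x₂ - x₃))

def ratioOne {F : Type} [Field F] (x₁ x₂ x₃ x₄ x₅ : F) : F :=
  -(((x₁ - x₂) * (x₁ - x₄) * (x₃ - x₅)) /
    ((x₁ - x₃) * (x₁ - x₅) * (x₂ - x₄)))

def ratioTwo {F : Type} [Field F] (x₁ x₂ x₃ x₄ x₅ : F) : F :=
  -(((x₁ - x₂) ^ 2 * (x₃ - x₄) * (x₃ - x₅)) /
    ((x₁ - x₃) * (x₁ - x₄) * (x₂ - x₃) * (x₂ - x₅)))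

def ratioThree {F : Type} [Field F] (x₁ x₂ x₃ x₄ x₅ : F) : F :=
  -(((x₁ - x₂) ^ 3 * (x₁ - x₅) * (x₃ - x₄) ^ 2 * (x₃ - x₅)) /
    ((x₁ - x₃) ^ 3 * (x₁ - x₄) * (x₂ - x₄) * (x₂ - x₅) ^ 2))

/-- The field `ℚ(x₁, …, x₅)`. -/
abbrev RatFun5 : Type := FractionRing (MvPolynomial (Fin 5) ℚ)

/-- The indeterminates of `ℚ(x₁, …, x₅)`. -/
def indet (i : Fin 5) : RatFun5 :=
  algebraMap (MvPolynomial (Fin 5) ℚ) RatFun5 (MvPolynomial.X i)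

/-- The (unnormalised) alternation
`∑_{σ ∈ 𝔖₅} sgn(σ) f(x_{σ(1)}, …, x_{σ(5)})` at the indeterminates. -/
def alt5 {M : Type} [AddCommGroup M]
    (f : RatFun5 → RatFun5 → RatFun5 → RatFun5 → RatFun5 → M) : M :=
  ∑ σ : Equiv.Perm (Fin 5), (Equiv.Perm.sign σ : ℤ) •
    f (indet (σ 0)) (indet (σ 1)) (indet (σ 2)) (indet (σ 3)) (indet (σ 4))

/-- Equality of symbols modulo `2`-torsion. -/
def EqModTwoTorsion {F : Type} [Field F] {N : ℕ} (s t : SymbolSpace F N) : Prop :=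
  s - t ∈ Submodule.torsionBy ℤ (SymbolSpace F N) 2

end

end NielsenSymbol

/-! Equality modulo 2-torsion means that twice the difference vanishes. Twice a pure tensor depends
only on the classes of its entries modulo signs, so after doubling, `symbolForm` is multilinear on
`LogSpace`. When all entries but the end point `z` lie in {0, 1}, every term of the symbol recursion
except the last is trivial modulo signs, so the doubled symbol is the single tensor (z - x_1) ⊗ ...
⊗ (z - x_N). Applying ρ_5 gives -(1-z) ∧ z ⊗ z ⊗ z ⊗ z for Li_5, and for S_{3,2} minus the sum of
the three tensors (1-z) ∧ z ⊗ ... with one further factor 1-z and two factors z.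

The arguments are chosen so that few irreducible factors occur. Modulo signs, R_1, R_2, R_3, CR and
1 - CR are products of powers of the differences x_i - x_j, while 1 - R_1 = P/d_1, 1 - R_2 = Q/d_2
and 1 - R_3 = PQ/d_3, with P = `factorOne`, Q = `factorTwo` and each d_i a product of differences.
By linearity in the first wedge slot the sum splits into three parts (`totalForm_eq`), each with
vanishing alternation.

P-part: 15 P ∧ R_1^{⊗4} + P ∧ R_3^{⊗4}. With indices 0 to 4, P is fixed up to sign by (3 4) and (1
3)(2 4). Writing u for R_1 and v for its image under (3 4), R_3 is u + 2v, and (1 3)(2 4) fixes u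
and negates v. Terms of odd degree in v cancel under this even permutation; the rest, 16u^4 + 16v^4
plus the mixed u, v terms, is symmetric under an odd one (`altSum_dihedral_eq_zero`).

Q-part: Q is fixed by the 3-cycle `rotation`, the three rotated classes a, b, c of R_2 add up to 0,
and R_3 is a - b. Then (a-b)^{⊗4} + (b-c)^{⊗4} + (c-a)^{⊗4} = 9(a^{⊗4} + b^{⊗4} + c^{⊗4})
(`altSum_rotation_eq_zero`).

The remaining core involves only differences, and there the S_{3,2} term with coefficient 11 is
needed. Expanding in the ten edges {i, j} makes it an identity between integers
(`altCoreForm_eq_zero`). Transitivity on edges fixes the first slot, and Kronecker substitution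
packs the 10^4 remaining coefficients into one large integer, which the kernel evaluates to 0. -/

namespace NielsenSymbol

noncomputable section

/-! ### Multiplicative classes modulo signs -/

section LogSpace

variable {F : Type} [Field F]

/-- The multiplicative group of `F`, written additively, modulo signs. -/
abbrev LogSpace (F : Type) [Field F] : Type :=
  Additive Fˣ ⧸ AddSubgroup.zmultiples (Additive.ofMul (-1 : Fˣ))

/-- The class of a unit modulo signs. -/
abbrev unitClass (u : Additive Fˣ) : LogSpace F := QuotientAddGroup.mk u

/-- The class of a nonzero element of `F` modulo signs (and `0` for the element `0`). -/
def logClass (z : F) : LogSpace F :=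
  open scoped Classical in
  if h : z = 0 then 0 else unitClass (Additive.ofMul (Units.mk0 z h))

lemma logClass_of_ne_zero {z : F} (h : z ≠ 0) :
    logClass z = unitClass (Additive.ofMul (Units.mk0 z h)) := dif_neg h

lemma logClass_mul {z w : F} (hz : z ≠ 0) (hw : w ≠ 0) :
    logClass (z * w) = logClass z + logClass w := by
  rw [logClass_of_ne_zero hz, logClass_of_ne_zero hw, logClass_of_ne_zero (mul_ne_zero hz hw),
    Units.mk0_mul, ofMul_mul]
  rfl

lemma logClass_one : logClass (1 : F) = 0 := by
  rw [logClass_of_ne_zero one_ne_zero, Units.mk0_one, ofMul_one]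
  rfl

lemma logClass_neg_one : logClass (-1 : F) = 0 := by
  rw [logClass_of_ne_zero (neg_ne_zero.2 one_ne_zero)]
  refine (QuotientAddGroup.eq_zero_iff _).2 ?_
  convert AddSubgroup.mem_zmultiples (Additive.ofMul (-1 : Fˣ)) using 2
  ext
  simp

lemma logClass_neg (z : F) : logClass (-z) = logClass z := by
  by_cases hz : z = 0
  · simp [hz]
  · rw [← neg_one_mul, logClass_mul (neg_ne_zero.2 one_ne_zero) hz, logClass_neg_one]
    exact zero_add (logClass z)

lemma logClass_sub_comm (z w : F) : logClass (z - w) = logClass (w - z) := by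
  rw [← neg_sub, logClass_neg]

lemma logClass_inv (z : F) : logClass z⁻¹ = -logClass z := by
  by_cases hz : z = 0
  · simp [hz, logClass]
  · refine eq_neg_of_add_eq_zero_left ?_
    rw [← logClass_mul (inv_ne_zero hz) hz, inv_mul_cancel₀ hz, logClass_one]

lemma logClass_div {z w : F} (hz : z ≠ 0) (hw : w ≠ 0) :
    logClass (z / w) = logClass z - logClass w := by
  rw [div_eq_mul_inv, logClass_mul hz (inv_ne_zero hw), logClass_inv, sub_eq_add_neg]

lemma logClass_pow {z : F} (hz : z ≠ 0) (n : ℕ) : logClass (z ^ n) = n • logClass z := by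
  induction n with
  | zero => simp [logClass_one]
  | succ n ih => rw [pow_succ, logClass_mul (pow_ne_zero n hz) hz, ih, succ_nsmul]

lemma unitClass_ofMul (u : Fˣ) : unitClass (Additive.ofMul u) = logClass (u : F) := by
  rw [logClass_of_ne_zero u.ne_zero, Units.mk0_val]

end LogSpace

/-! ### Doubled tensors as multilinear forms, and the action of ρ -/

section SymbolForm

variable {F : Type} [Field F] {N : ℕ}

lemma two_smul_tprod_update_sign (v : Fin N → Additive Fˣ) (i : Fin N) {a : Additive Fˣ}
    (ha : a ∈ AddSubgroup.zmultiples (Additive.ofMul (-1 : Fˣ))) :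
    (2 : ℤ) • PiTensorProduct.tprod ℤ (Function.update v i a) = 0 := by
  obtain ⟨n, rfl⟩ := ha
  have h : (2 : ℤ) • Additive.ofMul (-1 : Fˣ) = 0 := by
    rw [← ofMul_zpow]
    simp
  rw [← MultilinearMap.map_update_smul]
  simp only
  rw [smul_comm, h, smul_zero, MultilinearMap.map_update_zero]

/-- The entries are replaced one at a time. Each replacement changes the tensor by one with an entry
in the subgroup generated by -1, which doubling kills. -/
lemma two_smul_tprod_congr {v w : Fin N → Additive Fˣ}
    (h : ∀ i, unitClass (v i) = unitClass (w i)) :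
    (2 : ℤ) • PiTensorProduct.tprod ℤ v = (2 : ℤ) • PiTensorProduct.tprod ℤ w := by
  have key : ∀ s : Finset (Fin N), (2 : ℤ) • PiTensorProduct.tprod ℤ (s.piecewise w v) =
      (2 : ℤ) • PiTensorProduct.tprod ℤ v := by
    intro s
    induction s using Finset.induction_on with
    | empty => simp
    | insert j s hj ih =>
      rw [Finset.piecewise_insert, ← ih, ← sub_eq_zero, ← smul_sub]
      have hu : s.piecewise w v = Function.update (s.piecewise w v) j (v j) := by
        rw [Function.eq_update_iff]
        exact ⟨Finset.piecewise_eq_of_notMem _ _ _ hj, fun _ _ => rfl⟩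
      conv_lhs => rw [hu, Function.update_idem, ← MultilinearMap.map_update_sub]
      refine two_smul_tprod_update_sign _ _ ?_
      rw [← QuotientAddGroup.eq_zero_iff]
      exact sub_eq_zero.2 (h j).symm
  have := key Finset.univ
  rw [Finset.piecewise_univ] at this
  exact this.symm

/-- Twice the pure tensor, as a multilinear function of the classes modulo signs. -/
def symbolForm (F : Type) [Field F] (N : ℕ) :
    MultilinearMap ℤ (fun _ : Fin N => LogSpace F) (SymbolSpace F N) where
  -- The representatives are arbitrary; the factor 2 makes the value independent of them.
  toFun v := (2 : ℤ) • PiTensorProduct.tprod ℤ (fun i => (v i).out)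
  map_update_add' v i x y := by
    have e : ∀ z : LogSpace F, ∀ a : Additive Fˣ, unitClass a = z →
        (2 : ℤ) • PiTensorProduct.tprod ℤ (fun j => (Function.update v i z j).out) =
        (2 : ℤ) • PiTensorProduct.tprod ℤ (Function.update (fun j => (v j).out) i a) := by
      intro z a ha
      refine two_smul_tprod_congr fun j => ?_
      rcases eq_or_ne j i with rfl | hj
      · simp [ha]
      · simp [hj]
    rw [e (x + y) (x.out + y.out) (by simp [unitClass]), e x x.out (by simp [unitClass]),
      e y y.out (by simp [unitClass]), MultilinearMap.map_update_add, smul_add]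
  map_update_smul' v i c x := by
    have e : ∀ z : LogSpace F, ∀ a : Additive Fˣ, unitClass a = z →
        (2 : ℤ) • PiTensorProduct.tprod ℤ (fun j => (Function.update v i z j).out) =
        (2 : ℤ) • PiTensorProduct.tprod ℤ (Function.update (fun j => (v j).out) i a) := by
      intro z a ha
      refine two_smul_tprod_congr fun j => ?_
      rcases eq_or_ne j i with rfl | hj
      · simp [ha]
      · simp [hj]
    rw [e (c • x) (c • x.out) (by simp [unitClass]), e x x.out (by simp [unitClass]),
      MultilinearMap.map_update_smul, smul_comm]

lemma symbolForm_apply (v : Fin N → LogSpace F) :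
    symbolForm F N v = (2 : ℤ) • PiTensorProduct.tprod ℤ (fun i => (v i).out) := rfl

lemma symbolForm_unitClass (v : Fin N → Additive Fˣ) :
    symbolForm F N (fun i => unitClass (v i)) = (2 : ℤ) • PiTensorProduct.tprod ℤ v :=
  two_smul_tprod_congr fun i => by simp [unitClass]

lemma snoc_tprod (v : Fin N → Additive Fˣ) (u : Additive Fˣ) :
    snoc (PiTensorProduct.tprod ℤ v) u = PiTensorProduct.tprod ℤ (Fin.snoc v u) := by
  have := TensorPower.tprod_mul_tprod (R := ℤ) (M := Additive Fˣ) v (fun _ : Fin 1 => u)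
  rw [TensorPower.gMul_eq_coe_linearMap] at this
  refine this.trans ?_
  rw [Fin.append_right_eq_snoc]

lemma snoc_smul (c : ℤ) (w : SymbolSpace F N) (u : Additive Fˣ) :
    snoc (c • w) u = c • snoc w u := by
  rw [snoc, snoc, ← TensorProduct.smul_tmul', map_smul]

lemma snoc_sub (w w' : SymbolSpace F N) (u : Additive Fˣ) :
    snoc (w - w') u = snoc w u - snoc w' u := by
  rw [snoc, snoc, snoc, TensorProduct.sub_tmul, map_sub]

lemma snoc_zero (u : Additive Fˣ) : snoc (0 : SymbolSpace F N) u = 0 := by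
  rw [snoc, TensorProduct.zero_tmul, map_zero]

lemma two_smul_snoc_of_unitClass_eq_zero (w : SymbolSpace F N) {u : Additive Fˣ}
    (hu : unitClass u = 0) : (2 : ℤ) • snoc w u = 0 := by
  have key : (2 : ℤ) • PiTensorProduct.tprod ℤ (fun _ : Fin 1 => u) = 0 := by
    have : (fun _ : Fin 1 => u) = Function.update (fun _ : Fin 1 => u) 0 u := by simp
    rw [this]
    exact two_smul_tprod_update_sign _ _ ((QuotientAddGroup.eq_zero_iff _).1 hu)
  rw [snoc, ← map_smul, ← TensorProduct.tmul_smul, key, TensorProduct.tmul_zero, map_zero]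

lemma snoc_symbolForm (v : Fin N → LogSpace F) (u : Additive Fˣ) :
    snoc (symbolForm F N v) u = symbolForm F (N + 1) (Fin.snoc v (unitClass u)) := by
  rw [symbolForm_apply, snoc_smul, snoc_tprod, ← symbolForm_unitClass]
  congr 1
  funext i
  refine Fin.lastCases ?_ (fun j => ?_) i
  · simp
  · simp [unitClass]

lemma onInit_tprod (f : SymbolSpace F N →ₗ[ℤ] SymbolSpace F N) (v : Fin (N + 1) → Additive Fˣ) :
    onInit f (PiTensorProduct.tprod ℤ v) =
      snoc (f (PiTensorProduct.tprod ℤ (Fin.init v))) (v (Fin.last N)) := by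
  conv_lhs => rw [← Fin.snoc_init_self v, ← snoc_tprod]
  simp [onInit, snoc]

lemma cyclicShift_tprod (v : Fin (N + 1) → Additive Fˣ) :
    cyclicShift F (N + 1) (PiTensorProduct.tprod ℤ v) =
      PiTensorProduct.tprod ℤ (Fin.snoc (Fin.tail v) (v 0)) := by
  rw [cyclicShift]
  simp only [LinearEquiv.coe_coe, PiTensorProduct.reindex_tprod, Equiv.symm_symm]
  congr 1
  funext i
  refine Fin.lastCases ?_ (fun j => ?_) i
  · simp
  · simp [Fin.tail]

/-- The recursion for `ρ` on (doubled) pure tensors. -/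
lemma rho_symbolForm (v : Fin (N + 2) → LogSpace F) :
    rho F (N + 2) (symbolForm F (N + 2) v) =
      snoc (rho F (N + 1) (symbolForm F (N + 1) (Fin.init v))) (v (Fin.last _)).out -
      snoc (rho F (N + 1) (symbolForm F (N + 1) (Fin.tail v))) (v 0).out := by
  rw [rho, symbolForm_apply, symbolForm_apply, symbolForm_apply]
  simp only [map_smul, LinearMap.comp_apply, LinearMap.sub_apply, LinearMap.id_apply, map_sub,
    cyclicShift_tprod, onInit_tprod, Fin.snoc_last, Fin.init_snoc, snoc_smul, smul_sub]
  rfl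

/-- The functional `2 (a ∧ b) ⊗ c ⊗ d ⊗ e`. -/
def wedgeForm (a b c d e : LogSpace F) : SymbolSpace F 5 :=
  symbolForm F 5 ![a, b, c, d, e] - symbolForm F 5 ![b, a, c, d, e]

lemma snoc_symbolForm_out (v : Fin N → LogSpace F) (x : LogSpace F) :
    snoc (symbolForm F N v) x.out = symbolForm F (N + 1) (Fin.snoc v x) := by
  rw [snoc_symbolForm]
  simp [unitClass]

lemma init_vecCons {α : Type} {n : ℕ} (a b : α) (v : Fin n → α) :
    (Fin.init (Matrix.vecCons a (Matrix.vecCons b v)) : Fin (n + 1) → α) =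
      Matrix.vecCons a (Fin.init (Matrix.vecCons b v) : Fin n → α) := by
  funext i
  refine Fin.cases rfl (fun j => rfl) i

lemma init_vecCons_empty {α : Type} (a : α) : (Fin.init ![a] : Fin 0 → α) = ![] :=
  Subsingleton.elim _ _

lemma rho_one (v : SymbolSpace F 1) : rho F 1 v = v := rfl

/-- `ρ₅ (a ⊗ b ⊗ b ⊗ b ⊗ b) = (a ∧ b) ⊗ b ⊗ b ⊗ b`. -/
lemma rho_five_one_four (a b : LogSpace F) :
    rho F 5 (symbolForm F 5 ![a, b, b, b, b]) = wedgeForm a b b b b := by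
  simp [rho_symbolForm, rho_one, init_vecCons, init_vecCons_empty, snoc_symbolForm_out,
    snoc_sub, snoc_zero, wedgeForm]

/-- `ρ₅ (a ⊗ a ⊗ b ⊗ b ⊗ b) = -(a ∧ b) ⊗ (a ⊗ b ⊗ b + b ⊗ a ⊗ b + b ⊗ b ⊗ a)`. -/
lemma rho_five_two_three (a b : LogSpace F) :
    rho F 5 (symbolForm F 5 ![a, a, b, b, b]) =
      -(wedgeForm a b a b b + wedgeForm a b b a b + wedgeForm a b b b a) := by
  simp [rho_symbolForm, rho_one, init_vecCons, init_vecCons_empty, snoc_symbolForm_out,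
    snoc_sub, snoc_zero, wedgeForm]
  abel

end SymbolForm

/-! ### Symbols of Li_5 and S_{3,2} -/

section Symb

/-- Modulo signs, a weight one integral with end points and argument in `{0, 1}` is trivial. -/
lemma unitClass_weightOne_zero_one {F : Type} [Field F] [DecidableEq F] {a b c : F}
    (ha : a = 0 ∨ a = 1)
    (hb : b = 0 ∨ b = 1) (hc : c = 0 ∨ c = 1) : unitClass (weightOne a b c) = 0 := by
  have h0 : unitClass (0 : Additive Fˣ) = 0 := rfl
  rcases ha with rfl | rfl <;> rcases hb with rfl | rfl <;> rcases hc with rfl | rfl <;>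
    simp [weightOne, h0, unitClass_ofMul, logClass_one, logClass_neg_one, -Units.mk0_one]

/-- Modulo signs, `I(a; b; z) = z - b` for `a, b ∈ {0, 1}`. -/
lemma unitClass_weightOne_last {F : Type} [Field F] [DecidableEq F] {a b z : F} (ha : a = 0 ∨ a = 1)
    (hb : b = 0 ∨ b = 1) (hz₀ : z ≠ 0) (hz₁ : z ≠ 1) :
    unitClass (weightOne a b z) = logClass (z - b) := by
  rcases ha with rfl | rfl <;> rcases hb with rfl | rfl <;>
    simp [weightOne, unitClass_ofMul, hz₀.symm, hz₁.symm, logClass_neg, logClass_sub_comm z 1]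

/-- Modulo signs, the symbol of `I(x₀; x₁, …, x_N; z)` with all `xᵢ ∈ {0, 1}` is
`(z - x₁) ⊗ ⋯ ⊗ (z - x_N)`. -/
lemma two_smul_symb {F : Type} [Field F] [DecidableEq F] {z : F} (hz₀ : z ≠ 0) (hz₁ : z ≠ 1) (N : ℕ)
    (x : Fin (N + 2) → F) (hlast : x (Fin.last _) = z)
    (hx : ∀ i : Fin (N + 1), x i.castSucc = 0 ∨ x i.castSucc = 1) :
    (2 : ℤ) • symb N x = symbolForm F N (fun i => logClass (z - x i.succ.castSucc)) := by
  induction N with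
  | zero =>
    rw [symb, symbolForm_apply]
    congr 2
    funext i
    exact i.elim0
  | succ N ih =>
    -- Only the deletion of the last interior point involves `z` in its weight one factor; all other
    -- factors are ±1 and die after doubling.
    rw [symb, Finset.smul_sum, Fin.sum_univ_castSucc, Finset.sum_eq_zero, zero_add]
    · rw [← snoc_smul, ih, snoc_symbolForm]
      · congr 1
        funext i
        refine Fin.lastCases ?_ (fun j => ?_) i
        · rw [Fin.snoc_last, Fin.succ_last, Fin.succ_last, hlast,
            unitClass_weightOne_last (hx _) (by simpa using hx (Fin.last _)) hz₀ hz₁]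
        · rw [Fin.snoc_castSucc]
          congr 3
          ext
          simp [Fin.succAbove, Fin.lt_def]
      · simpa [Fin.succAbove, Fin.lt_def] using hlast
      · intro i
        rw [Fin.succAbove_of_castSucc_lt _ _ (by simp [Fin.lt_def]; omega)]
        exact hx _
    · intro j _
      refine two_smul_snoc_of_unitClass_eq_zero _ (unitClass_weightOne_zero_one ?_ ?_ ?_)
      · exact hx _
      · exact hx _
      · rw [Fin.succ_castSucc, Fin.succ_castSucc]
        exact hx _

/-- Modulo signs, the mod-products symbol of `Li₅(z)`. -/
lemma two_smul_li5Symb {F : Type} [Field F] [DecidableEq F] {z : F} (hz₀ : z ≠ 0) (hz₁ : z ≠ 1) :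
    (2 : ℤ) • li5Symb z =
      -wedgeForm (logClass (1 - z)) (logClass z) (logClass z) (logClass z) (logClass z) := by
  rw [li5Symb, nielsenSymb, smul_comm, modProductsSymb, ← map_smul, two_smul_symb hz₀ hz₁,
    ← rho_five_one_four, pow_one, neg_one_smul]
  · congr 3
    funext i
    fin_cases i <;> simp [logClass_sub_comm z 1]
  · simp
  · intro i
    fin_cases i <;> simp

/-- Modulo signs, the mod-products symbol of `S_{3,2}(z)`. -/
lemma two_smul_nielsenSymb_three_two {F : Type} [Field F] [DecidableEq F] {z : F}
    (hz₀ : z ≠ 0) (hz₁ : z ≠ 1) :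
    (2 : ℤ) • nielsenSymb 3 2 z =
      -(wedgeForm (logClass (1 - z)) (logClass z) (logClass (1 - z)) (logClass z) (logClass z) +
        wedgeForm (logClass (1 - z)) (logClass z) (logClass z) (logClass (1 - z)) (logClass z) +
        wedgeForm (logClass (1 - z)) (logClass z) (logClass z) (logClass z)
          (logClass (1 - z))) := by
  rw [nielsenSymb, smul_comm, modProductsSymb, ← map_smul, two_smul_symb hz₀ hz₁,
    ← rho_five_two_three, even_two.neg_one_pow, one_smul]
  · congr 2
    funext i
    fin_cases i <;> simp [logClass_sub_comm z 1]
  · simp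
  · intro i
    fin_cases i <;> simp

end Symb

/-! ### Linear forms in the differences and the core of the symbol -/

section LinearForms

variable (A : Type) [AddCommGroup A]

/-- The coordinate `y ↦ y i j`, where `y i j` stands for the class of `xᵢ - xⱼ`. -/
def edgeCoord (i j : Fin 5) : (Fin 5 → Fin 5 → A) →ₗ[ℤ] A :=
  LinearMap.proj (R := ℤ) (φ := fun _ : Fin 5 => A) j ∘ₗ
    LinearMap.proj (R := ℤ) (φ := fun _ : Fin 5 => Fin 5 → A) i

/-- The class of the cross-ratio `z`. -/
def crossForm : (Fin 5 → Fin 5 → A) →ₗ[ℤ] A :=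
  edgeCoord A 0 2 + edgeCoord A 1 3 - (edgeCoord A 0 3 + edgeCoord A 1 2)

/-- The class of `1 - z` for the cross-ratio `z`. -/
def crossComplForm : (Fin 5 → Fin 5 → A) →ₗ[ℤ] A :=
  edgeCoord A 0 1 + edgeCoord A 2 3 - (edgeCoord A 0 3 + edgeCoord A 1 2)

/-- The class of the numerator of `ratioOne`. -/
def numOne : (Fin 5 → Fin 5 → A) →ₗ[ℤ] A :=
  edgeCoord A 0 1 + edgeCoord A 0 3 + edgeCoord A 2 4

/-- The class of the denominator of `ratioOne`. -/
def denOne : (Fin 5 → Fin 5 → A) →ₗ[ℤ] A :=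
  edgeCoord A 0 2 + edgeCoord A 0 4 + edgeCoord A 1 3

/-- The class of the numerator of `ratioTwo`. -/
def numTwo : (Fin 5 → Fin 5 → A) →ₗ[ℤ] A :=
  (2 : ℤ) • edgeCoord A 0 1 + edgeCoord A 2 3 + edgeCoord A 2 4

/-- The class of the denominator of `ratioTwo`. -/
def denTwo : (Fin 5 → Fin 5 → A) →ₗ[ℤ] A :=
  edgeCoord A 0 2 + edgeCoord A 0 3 + edgeCoord A 1 2 + edgeCoord A 1 4

/-- The class of the numerator of `ratioThree`. -/
def numThree : (Fin 5 → Fin 5 → A) →ₗ[ℤ] A :=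
  (3 : ℤ) • edgeCoord A 0 1 + edgeCoord A 0 4 + (2 : ℤ) • edgeCoord A 2 3 + edgeCoord A 2 4

/-- The class of the denominator of `ratioThree`. -/
def denThree : (Fin 5 → Fin 5 → A) →ₗ[ℤ] A :=
  (3 : ℤ) • edgeCoord A 0 2 + edgeCoord A 0 3 + edgeCoord A 1 3 + (2 : ℤ) • edgeCoord A 1 4

/-- Permutation of the indices. -/
def permute (σ : Equiv.Perm (Fin 5)) : (Fin 5 → Fin 5 → A) →ₗ[ℤ] (Fin 5 → Fin 5 → A) where
  toFun y i j := y (σ i) (σ j)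
  map_add' _ _ := rfl
  map_smul' _ _ := rfl

end LinearForms

section Forms

variable {A M : Type} [AddCommGroup A] [AddCommGroup M]

lemma edgeCoord_apply (i j : Fin 5) (y : Fin 5 → Fin 5 → A) : edgeCoord A i j y = y i j := rfl

lemma permute_apply (σ : Equiv.Perm (Fin 5)) (y : Fin 5 → Fin 5 → A) (i j : Fin 5) :
    permute A σ y i j = y (σ i) (σ j) := rfl

lemma permute_mul (σ τ : Equiv.Perm (Fin 5)) (y : Fin 5 → Fin 5 → A) :
    permute A (σ * τ) y = permute A τ (permute A σ y) := rfl

/-- `(f ∧ g) ⊗ h ⊗ k ⊗ l` for linear forms `f, g, h, k, l`. -/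
def wedgeComp (T : MultilinearMap ℤ (fun _ : Fin 5 => A) M)
    (f g h k l : (Fin 5 → Fin 5 → A) →ₗ[ℤ] A) :
    MultilinearMap ℤ (fun _ : Fin 5 => Fin 5 → Fin 5 → A) M :=
  T.compLinearMap ![f, g, h, k, l] - T.compLinearMap ![g, f, h, k, l]

lemma wedgeComp_apply (T : MultilinearMap ℤ (fun _ : Fin 5 => A) M)
    (f g h k l : (Fin 5 → Fin 5 → A) →ₗ[ℤ] A) (y : Fin 5 → Fin 5 → Fin 5 → A) :
    wedgeComp T f g h k l y =
      T ![f (y 0), g (y 1), h (y 2), k (y 3), l (y 4)] -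
      T ![g (y 0), f (y 1), h (y 2), k (y 3), l (y 4)] := by
  rw [wedgeComp, sub_apply, MultilinearMap.compLinearMap_apply, MultilinearMap.compLinearMap_apply]
  congr 2 <;>
  · funext i
    fin_cases i <;> rfl

/-- The part of the symbol that involves only the differences `xᵢ - xⱼ`. -/
def coreForm (T : MultilinearMap ℤ (fun _ : Fin 5 => A) M) :
    MultilinearMap ℤ (fun _ : Fin 5 => Fin 5 → Fin 5 → A) M :=
  (11 : ℤ) •
      (wedgeComp T (crossComplForm A) (crossForm A)
        (crossComplForm A) (crossForm A) (crossForm A)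
      + wedgeComp T (crossComplForm A) (crossForm A)
        (crossForm A) (crossComplForm A) (crossForm A)
      + wedgeComp T (crossComplForm A) (crossForm A)
        (crossForm A) (crossForm A) (crossComplForm A))
    - (15 : ℤ) • wedgeComp T (denOne A) (numOne A)
        (numOne A - denOne A) (numOne A - denOne A) (numOne A - denOne A)
    + (9 : ℤ) • wedgeComp T (denTwo A) (numTwo A)
        (numTwo A - denTwo A) (numTwo A - denTwo A) (numTwo A - denTwo A)
    - wedgeComp T (denThree A) (numThree A)
        (numThree A - denThree A) (numThree A - denThree A) (numThree A - denThree A)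

/-- The alternation of `coreForm`. -/
def altCoreForm (T : MultilinearMap ℤ (fun _ : Fin 5 => A) M) :
    MultilinearMap ℤ (fun _ : Fin 5 => Fin 5 → Fin 5 → A) M :=
  ∑ σ : Equiv.Perm (Fin 5), (Equiv.Perm.sign σ : ℤ) •
    (coreForm T).compLinearMap (fun _ => permute A σ)

lemma altCoreForm_apply (T : MultilinearMap ℤ (fun _ : Fin 5 => A) M)
    (y : Fin 5 → Fin 5 → Fin 5 → A) :
    altCoreForm T y = ∑ σ : Equiv.Perm (Fin 5), (Equiv.Perm.sign σ : ℤ) •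
      coreForm T (fun i => permute A σ (y i)) := by
  simp [altCoreForm]

/-- Reindexing by σ ↦ τσ absorbs the permutation of the arguments. This antisymmetry later allows
the first edge to be normalised. -/
lemma altCoreForm_permute (T : MultilinearMap ℤ (fun _ : Fin 5 => A) M)
    (y : Fin 5 → Fin 5 → Fin 5 → A) (τ : Equiv.Perm (Fin 5)) :
    altCoreForm T (fun i => permute A τ (y i)) =
      (Equiv.Perm.sign τ : ℤ) • altCoreForm T y := by
  rw [altCoreForm_apply, altCoreForm_apply, Finset.smul_sum]
  conv_rhs => rw [← Equiv.sum_comp (Equiv.mulLeft τ)]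
  refine Finset.sum_congr rfl fun σ _ => ?_
  rw [Equiv.coe_mulLeft, smul_smul, Equiv.Perm.sign_mul, ← Units.val_mul, ← mul_assoc,
    Int.units_mul_self, one_mul]
  rfl

/-- The product of integers as a multilinear map. -/
abbrev mulForm : MultilinearMap ℤ (fun _ : Fin 5 => ℤ) ℤ := MultilinearMap.mkPiAlgebra ℤ (Fin 5) ℤ

/-- The multiple of `x` by an integer-valued function on pairs. -/
def smulEdge (c : Fin 5 → Fin 5 → ℤ) (x : A) : Fin 5 → Fin 5 → A := fun i j => c i j • x

lemma edgeCoord_smulEdge (i j : Fin 5) (c : Fin 5 → Fin 5 → ℤ) (x : A) :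
    edgeCoord A i j (smulEdge c x) = edgeCoord ℤ i j c • x := rfl

lemma permute_smulEdge (σ : Equiv.Perm (Fin 5)) (c : Fin 5 → Fin 5 → ℤ) (x : A) :
    permute A σ (smulEdge c x) = smulEdge (permute ℤ σ c) x := rfl

/-- The primed forms are meant to be the same integral linear forms evaluated over ℤ. Multilinearity
pulls the integers out, so the coefficient of `T x` is universal, given by `mulForm`; a statement
about every `T` thus becomes one about integers. -/
lemma wedgeComp_smulEdge (T : MultilinearMap ℤ (fun _ : Fin 5 => A) M)
    {f g h k l : (Fin 5 → Fin 5 → A) →ₗ[ℤ] A} {f' g' h' k' l' : (Fin 5 → Fin 5 → ℤ) →ₗ[ℤ] ℤ}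
    (hf : ∀ c x, f (smulEdge c x) = f' c • x) (hg : ∀ c x, g (smulEdge c x) = g' c • x)
    (hh : ∀ c x, h (smulEdge c x) = h' c • x) (hk : ∀ c x, k (smulEdge c x) = k' c • x)
    (hl : ∀ c x, l (smulEdge c x) = l' c • x)
    (c : Fin 5 → Fin 5 → Fin 5 → ℤ) (x : Fin 5 → A) :
    wedgeComp T f g h k l (fun i => smulEdge (c i) (x i)) =
      wedgeComp mulForm f' g' h' k' l' c • T x := by
  have key : ∀ r : Fin 5 → ℤ, T ![r 0 • x 0, r 1 • x 1, r 2 • x 2, r 3 • x 3, r 4 • x 4] =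
      mulForm r • T x := by
    intro r
    rw [MultilinearMap.mkPiAlgebra_apply, ← MultilinearMap.map_smul_univ]
    congr 1
    funext i
    fin_cases i <;> rfl
  rw [wedgeComp_apply, wedgeComp_apply, sub_smul, ← key, ← key]
  simp only [hf, hg, hh, hk, hl]
  rfl

lemma coreForm_smulEdge (T : MultilinearMap ℤ (fun _ : Fin 5 => A) M)
    (c : Fin 5 → Fin 5 → Fin 5 → ℤ) (x : Fin 5 → A) :
    coreForm T (fun i => smulEdge (c i) (x i)) = coreForm mulForm c • T x := by
  have ha : ∀ c x, crossComplForm A (smulEdge c x) = crossComplForm ℤ c • x := fun c x => by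
    simp [crossComplForm, edgeCoord_smulEdge, add_smul, sub_smul]
  have hc : ∀ c x, crossForm A (smulEdge c x) = crossForm ℤ c • x := fun c x => by
    simp [crossForm, edgeCoord_smulEdge, add_smul, sub_smul]
  have hn₁ : ∀ c x, numOne A (smulEdge c x) = numOne ℤ c • x := fun c x => by
    simp [numOne, edgeCoord_smulEdge, add_smul]
  have hd₁ : ∀ c x, denOne A (smulEdge c x) = denOne ℤ c • x := fun c x => by
    simp [denOne, edgeCoord_smulEdge, add_smul]
  have hn₂ : ∀ c x, numTwo A (smulEdge c x) = numTwo ℤ c • x := fun c x => by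
    simp [numTwo, edgeCoord_smulEdge, add_smul, mul_smul]
  have hd₂ : ∀ c x, denTwo A (smulEdge c x) = denTwo ℤ c • x := fun c x => by
    simp [denTwo, edgeCoord_smulEdge, add_smul]
  have hn₃ : ∀ c x, numThree A (smulEdge c x) = numThree ℤ c • x := fun c x => by
    simp [numThree, edgeCoord_smulEdge, add_smul, mul_smul]
  have hd₃ : ∀ c x, denThree A (smulEdge c x) = denThree ℤ c • x := fun c x => by
    simp [denThree, edgeCoord_smulEdge, add_smul, mul_smul]
  have hsub : ∀ {f g : (Fin 5 → Fin 5 → A) →ₗ[ℤ] A} {f' g' : (Fin 5 → Fin 5 → ℤ) →ₗ[ℤ] ℤ},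
      (∀ c x, f (smulEdge c x) = f' c • x) → (∀ c x, g (smulEdge c x) = g' c • x) →
      ∀ c x, (f - g) (smulEdge c x) = (f' - g') c • x := fun hf hg c x => by
    rw [LinearMap.sub_apply, LinearMap.sub_apply, sub_smul, hf, hg]
  simp only [coreForm, add_apply, sub_apply, smul_apply]
  rw [wedgeComp_smulEdge T ha hc ha hc hc, wedgeComp_smulEdge T ha hc hc ha hc,
    wedgeComp_smulEdge T ha hc hc hc ha,
    wedgeComp_smulEdge T hd₁ hn₁ (hsub hn₁ hd₁) (hsub hn₁ hd₁) (hsub hn₁ hd₁),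
    wedgeComp_smulEdge T hd₂ hn₂ (hsub hn₂ hd₂) (hsub hn₂ hd₂) (hsub hn₂ hd₂),
    wedgeComp_smulEdge T hd₃ hn₃ (hsub hn₃ hd₃) (hsub hn₃ hd₃) (hsub hn₃ hd₃)]
  module

lemma altCoreForm_smulEdge (T : MultilinearMap ℤ (fun _ : Fin 5 => A) M)
    (c : Fin 5 → Fin 5 → Fin 5 → ℤ) (x : Fin 5 → A) :
    altCoreForm T (fun i => smulEdge (c i) (x i)) = altCoreForm mulForm c • T x := by
  simp only [altCoreForm_apply, permute_smulEdge, coreForm_smulEdge, Finset.sum_smul, smul_assoc]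

end Forms

/-! ### Kronecker substitution for bounded integer multilinear maps -/

section Kronecker

lemma abs_sum_mul_pow_lt {b : ℤ} (n : ℕ) (e : Fin n → ℤ) (he : ∀ i, |e i| < b) :
    |∑ i, e i * b ^ (i : ℕ)| < b ^ n := by
  induction n with
  | zero => simp
  | succ n ih =>
    have hb : 0 < b := (abs_nonneg _).trans_lt (he 0)
    rw [Fin.sum_univ_castSucc]
    have h1 := ih (fun i => e i.castSucc) (fun i => he _)
    have h2 : |e (Fin.last n) * b ^ n| ≤ (b - 1) * b ^ n := by
      rw [abs_mul, abs_of_pos (pow_pos hb n)]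
      exact mul_le_mul_of_nonneg_right (Int.le_sub_one_of_lt (he _)) (pow_pos hb n).le
    refine (abs_add_le _ _).trans_lt ?_
    calc _ < b ^ n + (b - 1) * b ^ n := add_lt_add_of_lt_of_le h1 h2
      _ = b ^ (n + 1) := by ring

/-- The lowest digit is divisible by `b` and smaller than `b` in absolute value, hence zero;
dividing by `b` moves on to the next digit. Signed digits are allowed because only representations
of 0 matter. -/
lemma eq_zero_of_sum_mul_pow_eq_zero {b : ℤ} (n : ℕ) (e : Fin n → ℤ) (he : ∀ i, |e i| < b)
    (h : ∑ i, e i * b ^ (i : ℕ) = 0) (i : Fin n) : e i = 0 := by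
  induction n with
  | zero => exact i.elim0
  | succ n ih =>
    have hb : 0 < b := (abs_nonneg _).trans_lt (he 0)
    have hs : ∑ i : Fin n, e i.succ * b ^ ((i.succ : Fin (n + 1)) : ℕ) =
        b * ∑ i : Fin n, e i.succ * b ^ (i : ℕ) := by
      rw [Finset.mul_sum]
      refine Finset.sum_congr rfl fun j _ => ?_
      rw [Fin.val_succ, pow_succ]
      ring
    rw [Fin.sum_univ_succ, hs, Fin.val_zero, pow_zero, mul_one] at h
    have h0 : e 0 = 0 := Int.eq_zero_of_abs_lt_dvd (m := b)
      ⟨-∑ i : Fin n, e i.succ * b ^ (i : ℕ), by linarith⟩ (he 0)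
    refine Fin.cases h0 (fun j => ?_) i
    refine ih (fun j => e j.succ) (fun j => he _) ?_ j
    rw [h0, zero_add] at h
    exact (mul_eq_zero.1 h).resolve_left hb.ne'

variable {V : Type} [AddCommGroup V] {m : ℕ}

/-- The vector with coordinates `1, b, b², …` in terms of the family `δ`. -/
def powerVec (δ : Fin m → V) (b : ℤ) : V := ∑ l : Fin m, b ^ (l : ℕ) • δ l

/-- Kronecker substitution: a bounded integer-valued multilinear map is determined on a family of
vectors by its value at a single point. -/
lemma kronecker_substitution (δ : Fin m → V) {b : ℤ} (n : ℕ) :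
    ∀ f : MultilinearMap ℤ (fun _ : Fin n => V) ℤ, (∀ w : Fin n → Fin m, |f (δ ∘ w)| < b) →
      |f (fun i => powerVec δ (b ^ m ^ (i.rev : ℕ)))| < b ^ m ^ n ∧
      (f (fun i => powerVec δ (b ^ m ^ (i.rev : ℕ))) = 0 → ∀ w : Fin n → Fin m, f (δ ∘ w) = 0) := by
  induction n with
  | zero =>
    intro f hf
    have h : ∀ v : Fin 0 → V, ∀ w, f v = f (δ ∘ w) := fun v w => congrArg f (Subsingleton.elim _ _)
    refine ⟨?_, fun h0 w => (h _ w).symm.trans h0⟩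
    rw [h _ Fin.elim0, pow_zero, pow_one]
    exact hf _
  | succ n ih =>
    intro f hf
    set z : Fin n → V := fun i => powerVec δ (b ^ m ^ (i.rev : ℕ)) with hz
    have hcons : (fun i : Fin (n + 1) => powerVec δ (b ^ m ^ (i.rev : ℕ))) =
        Fin.cons (powerVec δ (b ^ m ^ n)) z := by
      funext i
      refine Fin.cases ?_ (fun j => ?_) i
      · simp
      · simp [hz, Fin.rev_succ]
    have hw : ∀ (l : Fin m) (w : Fin n → Fin m), f.curryLeft (δ l) (δ ∘ w) =
        f (δ ∘ Fin.cons l w) := by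
      intro l w
      rw [MultilinearMap.curryLeft_apply]
      congr 1
      funext i
      refine Fin.cases rfl (fun j => rfl) i
    have hl := fun l => ih (f.curryLeft (δ l)) (fun w => by rw [hw]; exact hf _)
    -- The first slot uses base `b ^ m ^ n`, exactly the bound the induction gives for the values in
    -- the other slots, so these values are the digits of an expansion in that base.
    have hsum : f (Fin.cons (powerVec δ (b ^ m ^ n)) z) =
        ∑ l : Fin m, f.curryLeft (δ l) z * (b ^ m ^ n) ^ (l : ℕ) := by
      rw [← MultilinearMap.curryLeft_apply, powerVec, map_sum, sum_apply]
      exact Finset.sum_congr rfl fun l _ => by rw [map_smul, smul_apply, smul_eq_mul, mul_comm]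
    rw [hcons, hsum]
    constructor
    · have := abs_sum_mul_pow_lt m _ (fun l => (hl l).1)
      rwa [← pow_mul, ← pow_succ] at this
    · intro h0 w
      have h1 := eq_zero_of_sum_mul_pow_eq_zero m _ (fun l => (hl l).1) h0 (w 0)
      have h2 := (hl (w 0)).2 h1 (Fin.tail w)
      rwa [hw, Fin.cons_self_tail] at h2

end Kronecker

/-! ### Vanishing of the core by one integer computation -/

section CoreIdentity

/-- The ten edges of the complete graph on five vertices. -/
def edge : Fin 10 → Fin 5 × Fin 5 :=
  ![(0, 1), (0, 2), (0, 3), (0, 4), (1, 2), (1, 3), (1, 4), (2, 3), (2, 4), (3, 4)]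

/-- The number of the edge `{i, j}`. -/
def edgeIndex : Fin 5 → Fin 5 → ℕ :=
  ![![0, 0, 1, 2, 3], ![0, 0, 4, 5, 6], ![1, 4, 0, 7, 8], ![2, 5, 7, 0, 9], ![3, 6, 8, 9, 0]]

/-- The indicator function of an edge. -/
def edgeInd (l : Fin 10) (i j : Fin 5) : ℤ := if (i, j) = edge l ∨ (j, i) = edge l then 1 else 0

lemma abs_edgeInd_le (l : Fin 10) (i j : Fin 5) : |edgeInd l i j| ≤ 1 := by
  unfold edgeInd
  split_ifs <;> simp

lemma edgeInd_of_ne : ∀ (i j : Fin 5), i ≠ j → ∀ l : Fin 10,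
    edgeInd l i j = if (l : ℕ) = edgeIndex i j then 1 else 0 := by
  decide +kernel

lemma edgeInd_self : ∀ (l : Fin 10) (i : Fin 5), edgeInd l i i = 0 := by
  decide +kernel

lemma edgeInd_comm (l : Fin 10) (i j : Fin 5) : edgeInd l i j = edgeInd l j i := by
  unfold edgeInd
  exact if_congr or_comm rfl rfl

lemma edgeIndex_lt : ∀ i j : Fin 5, edgeIndex i j < 10 := by
  decide +kernel

lemma edge_edgeIndex : ∀ i j : Fin 5, i ≠ j →
    edge ⟨edgeIndex i j, edgeIndex_lt i j⟩ = (i, j) ∨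
      edge ⟨edgeIndex i j, edgeIndex_lt i j⟩ = (j, i) := by
  decide +kernel

lemma sum_edgeInd_smul {A : Type} [AddCommGroup A] (x : Fin 10 → A) {i j : Fin 5} (h : i ≠ j) :
    ∑ l, edgeInd l i j • x l = x ⟨edgeIndex i j, edgeIndex_lt i j⟩ := by
  rw [Finset.sum_eq_single ⟨edgeIndex i j, edgeIndex_lt i j⟩]
  · rw [edgeInd_of_ne i j h, if_pos rfl, one_smul]
  · intro l _ hl
    rw [edgeInd_of_ne i j h, if_neg (fun h' => hl (Fin.ext h')), zero_smul]
  · simp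

/-- A symmetric function that vanishes on the diagonal is determined by its values on edges. -/
lemma eq_sum_smulEdge {A : Type} [AddCommGroup A] {y : Fin 5 → Fin 5 → A}
    (hsymm : ∀ i j, y i j = y j i) (hdiag : ∀ i, y i i = 0) :
    y = ∑ l, smulEdge (edgeInd l) (y (edge l).1 (edge l).2) := by
  funext i j
  rw [Finset.sum_apply, Finset.sum_apply]
  simp only [smulEdge]
  rcases eq_or_ne i j with rfl | h
  · simp [edgeInd_self, hdiag]
  · rw [sum_edgeInd_smul (fun l => y (edge l).1 (edge l).2) h]
    rcases edge_edgeIndex i j h with h' | h' <;> rw [h']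
    exact hsymm i j

/-- The values of `powerVec edgeInd (2 ^ s)`. -/
def powerTable (s : ℕ) (i j : Fin 5) : ℤ := if i = j then 0 else 2 ^ (s * edgeIndex i j)

lemma powerVec_edgeInd (s k : ℕ) :
    powerVec edgeInd ((2 ^ s) ^ 10 ^ k) = powerTable (s * 10 ^ k) := by
  funext i j
  rw [powerVec, Finset.sum_apply, Finset.sum_apply, powerTable]
  split_ifs with h
  · simp [h, edgeInd_self]
  · simp only [Pi.smul_apply, smul_eq_mul]
    simp_rw [mul_comm _ (edgeInd _ i j), ← smul_eq_mul (a := edgeInd _ i j)]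
    rw [sum_edgeInd_smul _ h, pow_mul, pow_mul]

/-- The explicit value of `coreForm mulForm`. -/
def coreValue (y₁ y₂ y₃ y₄ y₅ : Fin 5 → Fin 5 → ℤ) : ℤ :=
  let a (y : Fin 5 → Fin 5 → ℤ) : ℤ := y 0 1 + y 2 3 - (y 0 3 + y 1 2)
  let c (y : Fin 5 → Fin 5 → ℤ) : ℤ := y 0 2 + y 1 3 - (y 0 3 + y 1 2)
  let n₁ (y : Fin 5 → Fin 5 → ℤ) : ℤ := y 0 1 + y 0 3 + y 2 4
  let d₁ (y : Fin 5 → Fin 5 → ℤ) : ℤ := y 0 2 + y 0 4 + y 1 3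
  let n₂ (y : Fin 5 → Fin 5 → ℤ) : ℤ := 2 * y 0 1 + y 2 3 + y 2 4
  let d₂ (y : Fin 5 → Fin 5 → ℤ) : ℤ := y 0 2 + y 0 3 + y 1 2 + y 1 4
  let n₃ (y : Fin 5 → Fin 5 → ℤ) : ℤ := 3 * y 0 1 + y 0 4 + 2 * y 2 3 + y 2 4
  let d₃ (y : Fin 5 → Fin 5 → ℤ) : ℤ := 3 * y 0 2 + y 0 3 + y 1 3 + 2 * y 1 4
  11 * ((a y₁ * c y₂ - c y₁ * a y₂) *
      (a y₃ * c y₄ * c y₅ + c y₃ * a y₄ * c y₅ + c y₃ * c y₄ * a y₅))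
    - 15 * ((d₁ y₁ * n₁ y₂ - n₁ y₁ * d₁ y₂) *
      ((n₁ y₃ - d₁ y₃) * (n₁ y₄ - d₁ y₄) * (n₁ y₅ - d₁ y₅)))
    + 9 * ((d₂ y₁ * n₂ y₂ - n₂ y₁ * d₂ y₂) *
      ((n₂ y₃ - d₂ y₃) * (n₂ y₄ - d₂ y₄) * (n₂ y₅ - d₂ y₅)))
    - (d₃ y₁ * n₃ y₂ - n₃ y₁ * d₃ y₂) *
      ((n₃ y₃ - d₃ y₃) * (n₃ y₄ - d₃ y₄) * (n₃ y₅ - d₃ y₅))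

lemma wedgeComp_mulForm (f g h k l : (Fin 5 → Fin 5 → ℤ) →ₗ[ℤ] ℤ)
    (y : Fin 5 → Fin 5 → Fin 5 → ℤ) :
    wedgeComp mulForm f g h k l y =
      (f (y 0) * g (y 1) - g (y 0) * f (y 1)) * (h (y 2) * k (y 3) * l (y 4)) := by
  simp only [wedgeComp_apply, MultilinearMap.mkPiAlgebra_apply, Fin.prod_univ_five,
    Matrix.cons_val]
  ring

lemma coreForm_mulForm (y : Fin 5 → Fin 5 → Fin 5 → ℤ) :
    coreForm mulForm y = coreValue (y 0) (y 1) (y 2) (y 3) (y 4) := by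
  simp only [coreForm, wedgeComp_mulForm, add_apply, sub_apply, smul_apply, LinearMap.sub_apply,
    ← mul_add]
  rfl

lemma abs_wedge_mul_le {p q r s x P Q X : ℤ} (hp : |p| ≤ P) (hq : |q| ≤ Q) (hr : |r| ≤ P)
    (hs : |s| ≤ Q) (hx : |x| ≤ X) : |(p * q - s * r) * x| ≤ 2 * P * Q * X := by
  have hP := (abs_nonneg _).trans hp
  have hQ := (abs_nonneg _).trans hq
  have h1 : |p * q| ≤ P * Q := by
    rw [abs_mul]
    exact mul_le_mul hp hq (abs_nonneg _) hP
  have h2 : |s * r| ≤ P * Q := by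
    rw [abs_mul, mul_comm]
    exact mul_le_mul hr hs (abs_nonneg _) hP
  rw [abs_mul]
  refine mul_le_mul ?_ hx (abs_nonneg _) (by positivity)
  linarith [abs_sub (p * q) (s * r)]

lemma abs_mul_three_le {p q r P Q R : ℤ} (hp : |p| ≤ P) (hq : |q| ≤ Q) (hr : |r| ≤ R) :
    |p * q * r| ≤ P * Q * R := by
  have hP := (abs_nonneg _).trans hp
  have hQ := (abs_nonneg _).trans hq
  rw [abs_mul, abs_mul]
  gcongr

/-- A crude bound suffices: it only has to keep the Kronecker base small enough for the kernel
computation. -/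
lemma abs_coreValue_le {y₁ y₂ y₃ y₄ y₅ : Fin 5 → Fin 5 → ℤ} (h₁ : ∀ i j, |y₁ i j| ≤ 1)
    (h₂ : ∀ i j, |y₂ i j| ≤ 1) (h₃ : ∀ i j, |y₃ i j| ≤ 1) (h₄ : ∀ i j, |y₄ i j| ≤ 1)
    (h₅ : ∀ i j, |y₅ i j| ≤ 1) : |coreValue y₁ y₂ y₃ y₄ y₅| ≤ 2 ^ 20 := by
  have ha : ∀ y : Fin 5 → Fin 5 → ℤ, (∀ i j, |y i j| ≤ 1) →
      |y 0 1 + y 2 3 - (y 0 3 + y 1 2)| ≤ 4 ∧ |y 0 2 + y 1 3 - (y 0 3 + y 1 2)| ≤ 4 ∧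
      |y 0 1 + y 0 3 + y 2 4| ≤ 3 ∧ |y 0 2 + y 0 4 + y 1 3| ≤ 3 ∧
      |2 * y 0 1 + y 2 3 + y 2 4| ≤ 4 ∧ |y 0 2 + y 0 3 + y 1 2 + y 1 4| ≤ 4 ∧
      |3 * y 0 1 + y 0 4 + 2 * y 2 3 + y 2 4| ≤ 7 ∧
      |3 * y 0 2 + y 0 3 + y 1 3 + 2 * y 1 4| ≤ 7 ∧
      |y 0 1 + y 0 3 + y 2 4 - (y 0 2 + y 0 4 + y 1 3)| ≤ 6 ∧
      |2 * y 0 1 + y 2 3 + y 2 4 - (y 0 2 + y 0 3 + y 1 2 + y 1 4)| ≤ 8 ∧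
      |3 * y 0 1 + y 0 4 + 2 * y 2 3 + y 2 4 - (3 * y 0 2 + y 0 3 + y 1 3 + 2 * y 1 4)| ≤ 14 := by
    intro y h
    simp only [abs_le] at h ⊢
    have h01 := h 0 1
    have h02 := h 0 2
    have h03 := h 0 3
    have h04 := h 0 4
    have h12 := h 1 2
    have h13 := h 1 3
    have h14 := h 1 4
    have h23 := h 2 3
    have h24 := h 2 4
    omega
  obtain ⟨a₁, c₁, n₁, d₁, p₁, q₁, r₁, s₁, -⟩ := ha y₁ h₁
  obtain ⟨a₂, c₂, n₂, d₂, p₂, q₂, r₂, s₂, -⟩ := ha y₂ h₂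
  obtain ⟨a₃, c₃, -, -, -, -, -, -, e₃, f₃, g₃⟩ := ha y₃ h₃
  obtain ⟨a₄, c₄, -, -, -, -, -, -, e₄, f₄, g₄⟩ := ha y₄ h₄
  obtain ⟨a₅, c₅, -, -, -, -, -, -, e₅, f₅, g₅⟩ := ha y₅ h₅
  have t₀ := abs_wedge_mul_le a₁ c₂ a₂ c₁ ((abs_add_three _ _ _).trans (add_le_add (add_le_add
    (abs_mul_three_le a₃ c₄ c₅) (abs_mul_three_le c₃ a₄ c₅)) (abs_mul_three_le c₃ c₄ a₅)))
  have t₁ := abs_wedge_mul_le d₁ n₂ d₂ n₁ (abs_mul_three_le e₃ e₄ e₅)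
  have t₂ := abs_wedge_mul_le q₁ p₂ q₂ p₁ (abs_mul_three_le f₃ f₄ f₅)
  have t₃ := abs_wedge_mul_le s₁ r₂ s₂ r₁ (abs_mul_three_le g₃ g₄ g₅)
  -- The bounds are 2·4·4·(3·4³), 2·3·3·6³, 2·4·4·8³ and 2·7·7·14³, from the coefficient sums of the
  -- linear forms.
  have key : ∀ A B C D : ℤ, |A| ≤ 6144 → |B| ≤ 3888 → |C| ≤ 16384 → |D| ≤ 268912 →
      |11 * A - 15 * B + 9 * C - D| ≤ 2 ^ 20 := by
    intro A B C D hA hB hC hD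
    rw [abs_le] at *
    omega
  exact key _ _ _ _ (t₀.trans (by norm_num)) (t₁.trans (by norm_num)) (t₂.trans (by norm_num))
    (t₃.trans (by norm_num))

lemma altCoreForm_mulForm (y : Fin 5 → Fin 5 → Fin 5 → ℤ) :
    altCoreForm mulForm y = ∑ σ : Equiv.Perm (Fin 5), (Equiv.Perm.sign σ : ℤ) *
      coreValue (fun i j => y 0 (σ i) (σ j)) (fun i j => y 1 (σ i) (σ j))
        (fun i j => y 2 (σ i) (σ j)) (fun i j => y 3 (σ i) (σ j)) (fun i j => y 4 (σ i) (σ j)) := by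
  simp only [altCoreForm_apply, coreForm_mulForm, smul_eq_mul]
  rfl

lemma abs_altCoreForm_mulForm_lt {y : Fin 5 → Fin 5 → Fin 5 → ℤ} (hy : ∀ k i j, |y k i j| ≤ 1) :
    |altCoreForm mulForm y| < 2 ^ 27 := by
  rw [altCoreForm_mulForm]
  refine (Finset.abs_sum_le_sum_abs _ _).trans_lt ?_
  -- There are 120 < 2^7 permutations, whence the base 2^27.
  refine (Finset.sum_le_card_nsmul Finset.univ _ (2 ^ 20) fun σ _ => ?_).trans_lt ?_
  · rw [abs_mul, Int.isUnit_iff_abs_eq.1 (Units.isUnit _), one_mul]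
    exact abs_coreValue_le (fun _ _ => hy _ _ _) (fun _ _ => hy _ _ _) (fun _ _ => hy _ _ _)
      (fun _ _ => hy _ _ _) (fun _ _ => hy _ _ _)
  · rw [Finset.card_univ, Fintype.card_perm, Fintype.card_fin]
    norm_num [Nat.factorial]

-- The whole finite verification. The exponents 27·10^k for k = 3, 2, 1, 0 come from the base 2^27
-- and the ten edges, one scale for each of the four free slots.
set_option maxRecDepth 100000 in
lemma alternating_sum_powerTable :
    ∑ σ : Equiv.Perm (Fin 5), (Equiv.Perm.sign σ : ℤ) *
      coreValue (fun i j => edgeInd 0 (σ i) (σ j)) (fun i j => powerTable 27000 (σ i) (σ j))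
        (fun i j => powerTable 2700 (σ i) (σ j)) (fun i j => powerTable 270 (σ i) (σ j))
        (fun i j => powerTable 27 (σ i) (σ j)) = 0 := by
  decide +kernel

lemma altCoreForm_edgeInd_zero (w : Fin 4 → Fin 10) :
    (altCoreForm mulForm).curryLeft (edgeInd 0) (edgeInd ∘ w) = 0 := by
  have hbound : ∀ w : Fin 4 → Fin 10,
      |(altCoreForm mulForm).curryLeft (edgeInd 0) (edgeInd ∘ w)| < 2 ^ 27 := by
    intro w
    rw [MultilinearMap.curryLeft_apply]
    refine abs_altCoreForm_mulForm_lt fun k i j => ?_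
    refine Fin.cases ?_ (fun k => ?_) k
    · exact abs_edgeInd_le _ _ _
    · exact abs_edgeInd_le _ _ _
  refine (kronecker_substitution edgeInd 4 _ hbound).2 ?_ w
  have hvec : (fun i : Fin 4 => powerVec edgeInd ((2 ^ 27) ^ 10 ^ (i.rev : ℕ))) =
      ![powerTable 27000, powerTable 2700, powerTable 270, powerTable 27] := by
    funext i
    rw [powerVec_edgeInd]
    fin_cases i <;> rfl
  rw [hvec, MultilinearMap.curryLeft_apply, altCoreForm_mulForm]
  exact alternating_sum_powerTable

lemma eq_zero_of_forall_comp {V : Type} [AddCommGroup V] {m n : ℕ} (δ : Fin m → V)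
    (f : MultilinearMap ℤ (fun _ : Fin n => V) ℤ) (hf : ∀ w : Fin n → Fin m, f (δ ∘ w) = 0)
    {y : Fin n → V} (c : Fin n → Fin m → ℤ) (hy : ∀ k, y k = ∑ l, c k l • δ l) : f y = 0 := by
  rw [funext hy, MultilinearMap.map_sum]
  refine Finset.sum_eq_zero fun w _ => ?_
  rw [MultilinearMap.map_smul_univ f (fun k => c k (w k)) (fun k => δ (w k))]
  exact smul_eq_zero_of_right _ (hf w)

/-- Vanishing on symmetric functions, if the first one is the indicator function of an edge. -/
lemma altCoreForm_edgeInd_zero_cons (y : Fin 4 → Fin 5 → Fin 5 → ℤ)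
    (hsymm : ∀ k i j, y k i j = y k j i) (hdiag : ∀ k i, y k i i = 0) :
    (altCoreForm mulForm).curryLeft (edgeInd 0) y = 0 := by
  refine eq_zero_of_forall_comp edgeInd _ altCoreForm_edgeInd_zero
    (fun k l => y k (edge l).1 (edge l).2) fun k => ?_
  conv_lhs => rw [eq_sum_smulEdge (hsymm k) (hdiag k)]
  refine Finset.sum_congr rfl fun l _ => ?_
  funext i j
  exact mul_comm _ _

lemma exists_perm_edgeInd : ∀ l : Fin 10, ∃ τ : Equiv.Perm (Fin 5), ∀ i j,
    edgeInd 0 (τ i) (τ j) = edgeInd l i j := by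
  decide +kernel

lemma altCoreForm_edgeInd (w : Fin 5 → Fin 10) :
    altCoreForm mulForm (fun k => edgeInd (w k)) = 0 := by
  obtain ⟨τ, hτ⟩ := exists_perm_edgeInd (w 0)
  have h := altCoreForm_edgeInd_zero_cons
    -- Moving the first edge to edge 0 moves the other indicators too. Their images are used only as
    -- symmetric functions vanishing on the diagonal, so there is no need to identify the image
    -- edges.
    (fun k => permute ℤ τ⁻¹ (edgeInd (w k.succ)))
    (fun k i j => edgeInd_comm _ _ _)
    (fun k i => edgeInd_self _ _)
  have e : (fun k => edgeInd (w k)) = fun k => permute ℤ τ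
      ((Fin.cons (edgeInd 0) fun k => permute ℤ τ⁻¹ (edgeInd (w k.succ)) :
        Fin 5 → Fin 5 → Fin 5 → ℤ) k) := by
    funext k
    refine Fin.cases ?_ (fun k => ?_) k
    · funext i j
      exact (hτ i j).symm
    · funext i j
      simp [permute_apply]
  rw [e, altCoreForm_permute]
  exact smul_eq_zero_of_right _ h

/-- The part of the alternating sum that involves only the differences `xᵢ - xⱼ` vanishes. -/
theorem altCoreForm_eq_zero {A M : Type} [AddCommGroup A] [AddCommGroup M]
    (T : MultilinearMap ℤ (fun _ : Fin 5 => A) M) {y : Fin 5 → Fin 5 → A}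
    (hsymm : ∀ i j, y i j = y j i) (hdiag : ∀ i, y i i = 0) :
    altCoreForm T (fun _ => y) = 0 := by
  rw [eq_sum_smulEdge hsymm hdiag, MultilinearMap.map_sum]
  refine Finset.sum_eq_zero fun w _ => ?_
  rw [altCoreForm_smulEdge T (fun k => edgeInd (w k)), altCoreForm_edgeInd, zero_smul]

end CoreIdentity

/-! ### Alternating sums with extra symmetry -/

section AlternatingSums

variable {A M : Type} [AddCommGroup A] [AddCommGroup M]

/-- The alternating sum of a function on permutations. -/
def altSum (f : Equiv.Perm (Fin 5) → M) : M :=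
  ∑ σ : Equiv.Perm (Fin 5), (Equiv.Perm.sign σ : ℤ) • f σ

lemma altSum_add (f g : Equiv.Perm (Fin 5) → M) :
    altSum (fun σ => f σ + g σ) = altSum f + altSum g := by
  simp [altSum, Finset.sum_add_distrib]

lemma altSum_neg (f : Equiv.Perm (Fin 5) → M) : altSum (fun σ => -f σ) = -altSum f := by
  simp [altSum]

lemma altSum_sub (f g : Equiv.Perm (Fin 5) → M) :
    altSum (fun σ => f σ - g σ) = altSum f - altSum g := by
  simp [altSum, smul_sub, Finset.sum_sub_distrib]

lemma altSum_mul_right (f : Equiv.Perm (Fin 5) → M) (τ : Equiv.Perm (Fin 5)) :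
    altSum (fun σ => f (σ * τ)) = (Equiv.Perm.sign τ : ℤ) • altSum f := by
  rw [altSum, altSum, Finset.smul_sum]
  conv_rhs => rw [← Equiv.sum_comp (Equiv.mulRight τ)]
  refine Finset.sum_congr rfl fun σ _ => ?_
  rw [Equiv.coe_mulRight, smul_smul, Equiv.Perm.sign_mul, ← Units.val_mul, mul_comm,
    mul_assoc, Int.units_mul_self, mul_one]

/-- The rotation of the first three indices. -/
def rotation : Equiv.Perm (Fin 5) := Equiv.swap 0 2 * Equiv.swap 1 2

/-- Indicator function of a set of representatives modulo `rotation`. -/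
def rotationSection (σ : Equiv.Perm (Fin 5)) : ℤ := if σ 0 < σ 1 ∧ σ 0 < σ 2 then 1 else 0

lemma rotationSection_sum : ∀ σ : Equiv.Perm (Fin 5), rotationSection σ +
    rotationSection (σ * rotation) + rotationSection (σ * rotation * rotation) = 1 := by
  decide +kernel

lemma mul_rotation_cube (σ : Equiv.Perm (Fin 5)) : σ * rotation * rotation * rotation = σ := by
  have h : rotation * (rotation * rotation) = 1 := by decide +kernel
  rw [mul_assoc, mul_assoc, h, mul_one]

lemma sign_rotation : Equiv.Perm.sign rotation = 1 := by
  decide +kernel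

/-- Averaging over the 3-cycle would only show that three times the sum vanishes, and `M` may have
3-torsion. Weighting by the indicator of coset representatives avoids the division by 3. -/
lemma altSum_eq_zero_of_rotation {f : Equiv.Perm (Fin 5) → M}
    (hf : ∀ σ, f σ + f (σ * rotation) + f (σ * rotation * rotation) = 0) : altSum f = 0 := by
  have h1 : altSum (fun σ => rotationSection (σ * rotation) • f σ) =
      altSum (fun σ => rotationSection σ • f (σ * rotation * rotation)) := by
    have := altSum_mul_right (fun σ => rotationSection σ • f (σ * rotation * rotation)) rotation
    rw [sign_rotation, Units.val_one, one_smul] at this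
    rw [← this]
    simp only [mul_rotation_cube]
  have h2 : altSum (fun σ => rotationSection (σ * rotation * rotation) • f σ) =
      altSum (fun σ => rotationSection σ • f (σ * rotation)) := by
    have h := altSum_mul_right (fun σ => rotationSection σ • f (σ * rotation))
      (rotation * rotation)
    rw [Equiv.Perm.sign_mul, sign_rotation, mul_one, Units.val_one, one_smul] at h
    rw [← h]
    simp only [← mul_assoc, mul_rotation_cube]
  have h3 : f = fun σ => rotationSection σ • f σ + rotationSection (σ * rotation) • f σ +
      rotationSection (σ * rotation * rotation) • f σ := by
    funext σ
    rw [← add_smul, ← add_smul, rotationSection_sum, one_smul]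
  rw [h3, altSum_add, altSum_add, h1, h2, ← altSum_add, ← altSum_add]
  refine Finset.sum_eq_zero fun σ _ => ?_
  beta_reduce
  rw [← smul_add, ← smul_add, add_right_comm, hf, smul_zero, smul_zero]

/-- With c = -(a + b), the three differences are a - b, a + 2b and -(2a + b). Their fourth tensor
powers add up to 9(a^{⊗4} + b^{⊗4} + c^{⊗4}), without any commutation of factors. -/
lemma altSum_rotation_eq_zero (Q : Equiv.Perm (Fin 5) → A →+ A →+ A →+ A →+ M)
    (a b : Equiv.Perm (Fin 5) → A) (hQ : ∀ σ, Q (σ * rotation) = Q σ)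
    (ha : ∀ σ, a (σ * rotation) = b σ) (hb : ∀ σ, b (σ * rotation) = -(a σ + b σ)) :
    altSum (fun σ => Q σ (a σ - b σ) (a σ - b σ) (a σ - b σ) (a σ - b σ) -
      9 • Q σ (a σ) (a σ) (a σ) (a σ)) = 0 := by
  refine altSum_eq_zero_of_rotation fun σ => ?_
  simp only [hQ, ha, hb, map_add, map_neg, map_sub, AddMonoidHom.add_apply, AddMonoidHom.neg_apply,
    AddMonoidHom.sub_apply]
  abel

/-- The coefficient 15 raises that of u^4 to 16, the coefficient of v^4 in (u + 2v)^4. The part even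
in v is then invariant under the odd τ, and the part odd in v changes sign under the even τ'. -/
lemma altSum_dihedral_eq_zero (Q : Equiv.Perm (Fin 5) → A →+ A →+ A →+ A →+ M)
    (u v : Equiv.Perm (Fin 5) → A) {τ τ' : Equiv.Perm (Fin 5)}
    (hτ : Equiv.Perm.sign τ = -1) (hτ' : Equiv.Perm.sign τ' = 1)
    (hQ : ∀ σ, Q (σ * τ) = Q σ) (hu : ∀ σ, u (σ * τ) = v σ) (hv : ∀ σ, v (σ * τ) = u σ)
    (hQ' : ∀ σ, Q (σ * τ') = Q σ) (hu' : ∀ σ, u (σ * τ') = u σ) (hv' : ∀ σ, v (σ * τ') = -v σ) :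
    altSum (fun σ => 15 • Q σ (u σ) (u σ) (u σ) (u σ) +
      Q σ (u σ + 2 • v σ) (u σ + 2 • v σ) (u σ + 2 • v σ) (u σ + 2 • v σ)) = 0 := by
  -- To avoid dividing by 2, `g` holds one term from each orbit of u ↔ v, and `h` holds half of the
  -- part odd in v, whose coefficients 2 and 8 are even.
  let g : Equiv.Perm (Fin 5) → M := fun σ => 16 • Q σ (u σ) (u σ) (u σ) (u σ) +
    4 • (Q σ (u σ) (u σ) (v σ) (v σ) + Q σ (u σ) (v σ) (u σ) (v σ) + Q σ (u σ) (v σ) (v σ) (u σ))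
  let h : Equiv.Perm (Fin 5) → M := fun σ =>
    Q σ (u σ) (u σ) (u σ) (v σ) + Q σ (u σ) (u σ) (v σ) (u σ) +
      Q σ (u σ) (v σ) (u σ) (u σ) + Q σ (v σ) (u σ) (u σ) (u σ) +
    4 • (Q σ (v σ) (v σ) (v σ) (u σ) + Q σ (v σ) (v σ) (u σ) (v σ) +
      Q σ (v σ) (u σ) (v σ) (v σ) + Q σ (u σ) (v σ) (v σ) (v σ))
  have key : (fun σ => 15 • Q σ (u σ) (u σ) (u σ) (u σ) +
      Q σ (u σ + 2 • v σ) (u σ + 2 • v σ) (u σ + 2 • v σ) (u σ + 2 • v σ)) =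
      fun σ => (g σ + g (σ * τ)) + (h σ - h (σ * τ')) := by
    funext σ
    simp only [g, h, hQ, hu, hv, hQ', hu', hv', two_nsmul, map_add, map_neg,
      AddMonoidHom.add_apply, AddMonoidHom.neg_apply]
    abel
  rw [key, altSum_add, altSum_add, altSum_sub, altSum_mul_right, altSum_mul_right, hτ, hτ']
  simp

end AlternatingSums

/-! ### The wedge as an iterated homomorphism -/

section WedgeHom

variable {A M : Type} [AddCommGroup A] [AddCommGroup M]

/-- A multilinear map in five variables as an iterated homomorphism. -/
def tensorHom (T : MultilinearMap ℤ (fun _ : Fin 5 => A) M) : A →+ A →+ A →+ A →+ A →+ M :=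
  have h : ∀ (v : Fin 5 → A) (i : Fin 5) (x y : A),
      T (Function.update v i (x + y)) = T (Function.update v i x) + T (Function.update v i y) :=
    fun v i x y => T.map_update_add v i x y
  have u : ∀ a b c d e x : A, Function.update ![a, b, c, d, e] 0 x = ![x, b, c, d, e] ∧
      Function.update ![a, b, c, d, e] 1 x = ![a, x, c, d, e] ∧
      Function.update ![a, b, c, d, e] 2 x = ![a, b, x, d, e] ∧
      Function.update ![a, b, c, d, e] 3 x = ![a, b, c, x, e] ∧
      Function.update ![a, b, c, d, e] 4 x = ![a, b, c, d, x] := by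
    intro a b c d e x
    refine ⟨?_, ?_, ?_, ?_, ?_⟩ <;> (funext i; fin_cases i <;> rfl)
  AddMonoidHom.mk' (fun a => AddMonoidHom.mk' (fun b => AddMonoidHom.mk' (fun c =>
    AddMonoidHom.mk' (fun d => AddMonoidHom.mk' (fun e => T ![a, b, c, d, e])
      (fun x y => by simpa only [u] using h ![a, b, c, d, 0] 4 x y))
      (fun x y => by
        ext e
        have hxy := h ![a, b, c, 0, e] 3 x y
        simp only [u] at hxy
        exact hxy))
      (fun x y => by
        ext d e
        have hxy := h ![a, b, 0, d, e] 2 x y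
        simp only [u] at hxy
        exact hxy))
      (fun x y => by
        ext c d e
        have hxy := h ![a, 0, c, d, e] 1 x y
        simp only [u] at hxy
        exact hxy))
      (fun x y => by
        ext b c d e
        have hxy := h ![0, b, c, d, e] 0 x y
        simp only [u] at hxy
        exact hxy)

/-- The iterated homomorphism `(a ∧ b) ⊗ c ⊗ d ⊗ e`. -/
def wedgeHom (T : MultilinearMap ℤ (fun _ : Fin 5 => A) M) : A →+ A →+ A →+ A →+ A →+ M :=
  tensorHom T - (tensorHom T).flip

lemma wedgeHom_apply (T : MultilinearMap ℤ (fun _ : Fin 5 => A) M) (a b c d e : A) :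
    wedgeHom T a b c d e = T ![a, b, c, d, e] - T ![b, a, c, d, e] := rfl

lemma wedgeHom_self (T : MultilinearMap ℤ (fun _ : Fin 5 => A) M) (a c d e : A) :
    wedgeHom T a a c d e = 0 := sub_self _

/-- The elements `π - d` and `n - d` span the same wedge as `π ∧ (n - d) - d ∧ n`. -/
lemma wedgeHom_sub_sub (T : MultilinearMap ℤ (fun _ : Fin 5 => A) M) (p n d x y z : A) :
    wedgeHom T (p - d) (n - d) x y z =
      wedgeHom T p (n - d) x y z - wedgeHom T d n x y z := by
  simp only [map_sub, AddMonoidHom.sub_apply, wedgeHom_self]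
  abel

lemma coreForm_const (T : MultilinearMap ℤ (fun _ : Fin 5 => A) M) (y : Fin 5 → Fin 5 → A) :
    coreForm T (fun _ => y) =
      11 • (wedgeHom T (crossComplForm A y) (crossForm A y)
          (crossComplForm A y) (crossForm A y) (crossForm A y)
        + wedgeHom T (crossComplForm A y) (crossForm A y)
          (crossForm A y) (crossComplForm A y) (crossForm A y)
        + wedgeHom T (crossComplForm A y) (crossForm A y)
          (crossForm A y) (crossForm A y) (crossComplForm A y))
      - 15 • wedgeHom T (denOne A y) (numOne A y)
          (numOne A y - denOne A y) (numOne A y - denOne A y) (numOne A y - denOne A y)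
      + 9 • wedgeHom T (denTwo A y) (numTwo A y)
          (numTwo A y - denTwo A y) (numTwo A y - denTwo A y) (numTwo A y - denTwo A y)
      - wedgeHom T (denThree A y) (numThree A y) (numThree A y - denThree A y)
          (numThree A y - denThree A y) (numThree A y - denThree A y) := by
  simp only [coreForm, wedgeComp_apply, wedgeHom_apply, add_apply, sub_apply, smul_apply,
    LinearMap.sub_apply]
  module

end WedgeHom

/-! ### Multiplicative relations between the ratios -/

section Forms

variable {A : Type} [AddCommGroup A] {y : Fin 5 → Fin 5 → A}

/-- The class of `ratioOne`. -/
abbrev formOne (y : Fin 5 → Fin 5 → A) : A := numOne A y - denOne A y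

/-- The class of `ratioTwo`. -/
abbrev formTwo (y : Fin 5 → Fin 5 → A) : A := numTwo A y - denTwo A y

/-- The class of `ratioThree`. -/
abbrev formThree (y : Fin 5 → Fin 5 → A) : A := numThree A y - denThree A y

lemma rotation_apply : rotation 0 = 2 ∧ rotation 1 = 0 ∧ rotation 2 = 1 ∧ rotation 3 = 3 ∧
    rotation 4 = 4 := by
  decide +kernel

lemma swap_apply : Equiv.swap (3 : Fin 5) 4 0 = 0 ∧ Equiv.swap (3 : Fin 5) 4 1 = 1 ∧
    Equiv.swap (3 : Fin 5) 4 2 = 2 ∧ Equiv.swap (3 : Fin 5) 4 3 = 4 ∧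
    Equiv.swap (3 : Fin 5) 4 4 = 3 := by
  decide +kernel

/-- The double transposition `(1 3)(2 4)`. -/
def doubleSwap : Equiv.Perm (Fin 5) := Equiv.swap 1 3 * Equiv.swap 2 4

lemma doubleSwap_apply : doubleSwap 0 = 0 ∧ doubleSwap 1 = 3 ∧ doubleSwap 2 = 4 ∧
    doubleSwap 3 = 1 ∧ doubleSwap 4 = 2 := by
  decide +kernel

/-- Multiplicatively and up to sign, R_3 is R_1 times the square of R_1 with its last two variables
exchanged. -/
lemma formThree_eq_add (y : Fin 5 → Fin 5 → A) :
    formThree y = formOne y + 2 • formOne (permute A (Equiv.swap 3 4) y) := by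
  simp only [formOne, formThree, numOne, denOne, numThree, denThree, LinearMap.add_apply,
    LinearMap.smul_apply, edgeCoord_apply, permute_apply, swap_apply]
  module

lemma formOne_permute_doubleSwap (hy : ∀ i j, y i j = y j i) :
    formOne (permute A doubleSwap y) = formOne y := by
  simp only [formOne, numOne, denOne, LinearMap.add_apply, edgeCoord_apply, permute_apply,
    doubleSwap_apply]
  rw [hy 4 2, hy 3 1]
  module

lemma formOne_permute_doubleSwap_swap (hy : ∀ i j, y i j = y j i) :
    formOne (permute A (doubleSwap * Equiv.swap 3 4) y) =
      -formOne (permute A (Equiv.swap 3 4) y) := by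
  simp only [formOne, numOne, denOne, LinearMap.add_apply, edgeCoord_apply, permute_mul,
    permute_apply, doubleSwap_apply, swap_apply]
  rw [hy 4 1, hy 3 2]
  module

/-- Up to sign, R_3 is also the quotient of R_2 by its rotation; this second factorisation serves
the terms containing `factorTwo`. -/
lemma formThree_eq_sub (hy : ∀ i j, y i j = y j i) :
    formThree y = formTwo y - formTwo (permute A rotation y) := by
  simp only [formTwo, formThree, numTwo, denTwo, numThree, denThree, LinearMap.add_apply,
    LinearMap.smul_apply, edgeCoord_apply, permute_apply, rotation_apply]
  rw [hy 2 0, hy 2 1]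
  module

lemma formTwo_permute_rotation_rotation (hy : ∀ i j, y i j = y j i) :
    formTwo (permute A (rotation * rotation) y) =
      -(formTwo y + formTwo (permute A rotation y)) := by
  simp only [formTwo, numTwo, denTwo, LinearMap.add_apply, LinearMap.smul_apply, edgeCoord_apply,
    permute_mul, permute_apply, rotation_apply]
  rw [hy 2 0, hy 2 1, hy 1 0]
  module

end Forms

/-! ### Splitting the alternating sum by irreducible factors -/

section AbstractIdentity

variable {A M : Type} [AddCommGroup A] [AddCommGroup M]

/-- The term of the alternating sum, with `p` and `q` the classes of the irreducible factors of
`1 - ratioOne` and `1 - ratioTwo`. -/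
def totalForm (T : MultilinearMap ℤ (fun _ : Fin 5 => A) M) (p q : A) (y : Fin 5 → Fin 5 → A) :
    M :=
  11 • (wedgeHom T (crossComplForm A y) (crossForm A y)
      (crossComplForm A y) (crossForm A y) (crossForm A y)
    + wedgeHom T (crossComplForm A y) (crossForm A y)
      (crossForm A y) (crossComplForm A y) (crossForm A y)
    + wedgeHom T (crossComplForm A y) (crossForm A y)
      (crossForm A y) (crossForm A y) (crossComplForm A y))
  + (15 • wedgeHom T (p - denOne A y) (formOne y) (formOne y) (formOne y) (formOne y)
    - 9 • wedgeHom T (q - denTwo A y) (formTwo y) (formTwo y) (formTwo y) (formTwo y)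
    + wedgeHom T (p + q - denThree A y) (formThree y) (formThree y) (formThree y) (formThree y))

/-- Since R_i = n_i/d_i, the wedge d_i ∧ R_i equals d_i ∧ n_i, which involves differences only. What
remains is linear in `p` and `q` separately, and R_3 contributes to both. -/
lemma totalForm_eq (T : MultilinearMap ℤ (fun _ : Fin 5 => A) M) (p q : A)
    (y : Fin 5 → Fin 5 → A) :
    totalForm T p q y = coreForm T (fun _ => y)
      + (15 • wedgeHom T p (formOne y) (formOne y) (formOne y) (formOne y)
        + wedgeHom T p (formThree y) (formThree y) (formThree y) (formThree y))
      + (wedgeHom T q (formThree y) (formThree y) (formThree y) (formThree y)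
        - 9 • wedgeHom T q (formTwo y) (formTwo y) (formTwo y) (formTwo y)) := by
  rw [totalForm, coreForm_const, wedgeHom_sub_sub, wedgeHom_sub_sub, wedgeHom_sub_sub, map_add]
  simp only [AddMonoidHom.add_apply]
  module

/-- The alternating sum vanishes as soon as the factors have the expected symmetries. -/
theorem altSum_totalForm_eq_zero (T : MultilinearMap ℤ (fun _ : Fin 5 => A) M)
    {y : Fin 5 → Fin 5 → A} (hsymm : ∀ i j, y i j = y j i) (hdiag : ∀ i, y i i = 0)
    {p q : Equiv.Perm (Fin 5) → A} (hp : ∀ σ, p (σ * Equiv.swap 3 4) = p σ)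
    (hp' : ∀ σ, p (σ * doubleSwap) = p σ) (hq : ∀ σ, q (σ * rotation) = q σ) :
    altSum (fun σ => totalForm T (p σ) (q σ) (permute A σ y)) = 0 := by
  have hs : ∀ (σ : Equiv.Perm (Fin 5)) (i j), permute A σ y i j = permute A σ y j i :=
    fun σ i j => hsymm _ _
  have h₁ : altSum (fun σ => coreForm T (fun _ => permute A σ y)) = 0 := by
    rw [← altCoreForm_eq_zero T hsymm hdiag, altCoreForm_apply]
    rfl
  have h₂ := altSum_dihedral_eq_zero (fun σ => wedgeHom T (p σ))
    (fun σ => formOne (permute A σ y)) (fun σ => formOne (permute A (σ * Equiv.swap 3 4) y))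
    (τ := Equiv.swap 3 4) (τ' := doubleSwap) (by decide +kernel) (by decide +kernel)
    (fun σ => by rw [hp]) (fun σ => rfl) (fun σ => by rw [mul_assoc, Equiv.swap_mul_self, mul_one])
    (fun σ => by rw [hp'])
    (fun σ => by rw [permute_mul, formOne_permute_doubleSwap (hs σ)])
    (fun σ => by
      rw [mul_assoc, permute_mul, formOne_permute_doubleSwap_swap (hs σ), permute_mul])
  have h₃ := altSum_rotation_eq_zero (fun σ => wedgeHom T (q σ))
    (fun σ => formTwo (permute A σ y)) (fun σ => formTwo (permute A (σ * rotation) y))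
    (fun σ => by rw [hq]) (fun σ => rfl)
    (fun σ => by
      rw [mul_assoc, permute_mul, formTwo_permute_rotation_rotation (hs σ), permute_mul])
  simp only [permute_mul, ← formThree_eq_add] at h₂
  simp only [permute_mul, ← formThree_eq_sub (hs _)] at h₃
  simp only [totalForm_eq]
  rw [altSum_add, altSum_add, h₁, h₂, h₃, add_zero, add_zero]

end AbstractIdentity

/-! ### Factorisations of 1 - R_i -/

section Ratios

/-- The new irreducible factor of the numerator of `1 - ratioOne`. -/
def factorOne {R : Type} [CommRing R] (x : Fin 5 → R) : R :=
  (x 0 - x 2) * (x 0 - x 4) * (x 1 - x 3) + (x 0 - x 1) * (x 0 - x 3) * (x 2 - x 4)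

/-- The new irreducible factor of the numerator of `1 - ratioTwo`. -/
def factorTwo {R : Type} [CommRing R] (x : Fin 5 → R) : R :=
  (x 0 - x 2) * (x 0 - x 3) * (x 1 - x 2) * (x 1 - x 4) +
    (x 0 - x 1) ^ 2 * (x 2 - x 3) * (x 2 - x 4)

lemma map_factorOne {R S : Type} [CommRing R] [CommRing S] (f : R →+* S) (x : Fin 5 → R) :
    f (factorOne x) = factorOne (fun i => f (x i)) := by
  simp [factorOne]

lemma map_factorTwo {R S : Type} [CommRing R] [CommRing S] (f : R →+* S) (x : Fin 5 → R) :
    f (factorTwo x) = factorTwo (fun i => f (x i)) := by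
  simp [factorTwo]

variable {F : Type} [Field F] {x : Fin 5 → F}

/-- The classes of the differences `xᵢ - xⱼ`. -/
def pairClass (x : Fin 5 → F) (i j : Fin 5) : LogSpace F := logClass (x i - x j)

lemma pairClass_comm (x : Fin 5 → F) (i j : Fin 5) : pairClass x i j = pairClass x j i :=
  logClass_sub_comm _ _

lemma pairClass_self (x : Fin 5 → F) (i : Fin 5) : pairClass x i i = 0 := by
  rw [pairClass, sub_self, logClass, dif_pos rfl]

lemma logClass_factorOne_swap (x : Fin 5 → F) :
    logClass (factorOne (x ∘ Equiv.swap 3 4)) = logClass (factorOne x) := by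
  congr 1
  simp only [factorOne, Function.comp_apply, swap_apply]
  ring

lemma logClass_factorOne_doubleSwap (x : Fin 5 → F) :
    logClass (factorOne (x ∘ doubleSwap)) = logClass (factorOne x) := by
  rw [← logClass_neg]
  congr 1
  simp only [factorOne, Function.comp_apply, doubleSwap_apply]
  ring

lemma logClass_factorTwo_rotation (x : Fin 5 → F) :
    logClass (factorTwo (x ∘ rotation)) = logClass (factorTwo x) := by
  congr 1
  simp only [factorTwo, Function.comp_apply, rotation_apply]
  ring

lemma crossRatio_facts (hx : ∀ i j, i ≠ j → x i - x j ≠ 0) :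
    crossRatio (x 0) (x 1) (x 2) (x 3) ≠ 0 ∧ crossRatio (x 0) (x 1) (x 2) (x 3) ≠ 1 ∧
    logClass (crossRatio (x 0) (x 1) (x 2) (x 3)) = crossForm (LogSpace F) (pairClass x) ∧
    logClass (1 - crossRatio (x 0) (x 1) (x 2) (x 3)) =
      crossComplForm (LogSpace F) (pairClass x) := by
  have h01 := hx 0 1 (by decide)
  have h02 := hx 0 2 (by decide)
  have h03 := hx 0 3 (by decide)
  have h12 := hx 1 2 (by decide)
  have h13 := hx 1 3 (by decide)
  have h23 := hx 2 3 (by decide)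
  have e : 1 - crossRatio (x 0) (x 1) (x 2) (x 3) =
      -(((x 0 - x 1) * (x 2 - x 3)) / ((x 0 - x 3) * (x 1 - x 2))) := by
    rw [crossRatio]
    field_simp
    ring
  refine ⟨?_, ?_, ?_, ?_⟩
  · simp [crossRatio, h02, h03, h12, h13]
  · rw [← sub_ne_zero, ← neg_ne_zero, neg_sub, e]
    simp [h01, h03, h12, h23]
  · rw [crossRatio, logClass_div (by simp [*]) (by simp [*]), logClass_mul h02 h13,
      logClass_mul h03 h12]
    rfl
  · rw [e, logClass_neg, logClass_div (by simp [*]) (by simp [*]), logClass_mul h01 h23,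
      logClass_mul h03 h12]
    rfl

lemma ratioOne_facts (hx : ∀ i j, i ≠ j → x i - x j ≠ 0) (hf : factorOne x ≠ 0) :
    ratioOne (x 0) (x 1) (x 2) (x 3) (x 4) ≠ 0 ∧ ratioOne (x 0) (x 1) (x 2) (x 3) (x 4) ≠ 1 ∧
    logClass (ratioOne (x 0) (x 1) (x 2) (x 3) (x 4)) = formOne (pairClass x) ∧
    logClass (1 - ratioOne (x 0) (x 1) (x 2) (x 3) (x 4)) =
      logClass (factorOne x) - denOne (LogSpace F) (pairClass x) := by
  have h01 := hx 0 1 (by decide)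
  have h02 := hx 0 2 (by decide)
  have h03 := hx 0 3 (by decide)
  have h04 := hx 0 4 (by decide)
  have h13 := hx 1 3 (by decide)
  have h24 := hx 2 4 (by decide)
  have e : 1 - ratioOne (x 0) (x 1) (x 2) (x 3) (x 4) =
      factorOne x / ((x 0 - x 2) * (x 0 - x 4) * (x 1 - x 3)) := by
    rw [ratioOne, factorOne]
    field_simp
    ring
  refine ⟨?_, ?_, ?_, ?_⟩
  · simp [ratioOne, h01, h02, h03, h04, h13, h24]
  · rw [ne_comm, ← sub_ne_zero, e]
    simp [hf, h02, h04, h13]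
  · rw [ratioOne, logClass_neg, logClass_div (by simp [*]) (by simp [*])]
    simp only [logClass_mul, mul_ne_zero, ne_eq, h01, h02, h03, h04, h13, h24, not_false_eq_true]
    rfl
  · rw [e, logClass_div hf (by simp [*])]
    simp only [logClass_mul, mul_ne_zero, ne_eq, h02, h04, h13, not_false_eq_true]
    rfl

lemma ratioTwo_facts (hx : ∀ i j, i ≠ j → x i - x j ≠ 0) (hf : factorTwo x ≠ 0) :
    ratioTwo (x 0) (x 1) (x 2) (x 3) (x 4) ≠ 0 ∧ ratioTwo (x 0) (x 1) (x 2) (x 3) (x 4) ≠ 1 ∧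
    logClass (ratioTwo (x 0) (x 1) (x 2) (x 3) (x 4)) = formTwo (pairClass x) ∧
    logClass (1 - ratioTwo (x 0) (x 1) (x 2) (x 3) (x 4)) =
      logClass (factorTwo x) - denTwo (LogSpace F) (pairClass x) := by
  have h01 := hx 0 1 (by decide)
  have h02 := hx 0 2 (by decide)
  have h03 := hx 0 3 (by decide)
  have h12 := hx 1 2 (by decide)
  have h14 := hx 1 4 (by decide)
  have h23 := hx 2 3 (by decide)
  have h24 := hx 2 4 (by decide)
  have e : 1 - ratioTwo (x 0) (x 1) (x 2) (x 3) (x 4) =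
      factorTwo x / ((x 0 - x 2) * (x 0 - x 3) * (x 1 - x 2) * (x 1 - x 4)) := by
    rw [ratioTwo, factorTwo]
    field_simp
    ring
  refine ⟨?_, ?_, ?_, ?_⟩
  · simp [ratioTwo, h01, h02, h03, h12, h14, h23, h24]
  · rw [ne_comm, ← sub_ne_zero, e]
    simp [hf, h02, h03, h12, h14]
  · rw [ratioTwo, logClass_neg, logClass_div (by simp [*]) (by simp [*])]
    rw [logClass_mul (by simp [*]) h24, logClass_mul (by simp [*]) h23, logClass_pow h01,
      logClass_mul (by simp [*]) h14, logClass_mul (by simp [*]) h12, logClass_mul h02 h03,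
      ← natCast_zsmul]
    rfl
  · rw [e, logClass_div hf (by simp [*])]
    rw [logClass_mul (by simp [*]) h14, logClass_mul (by simp [*]) h12, logClass_mul h02 h03]
    rfl

/-- The decisive coincidence is that the numerator of 1 - R_3 is exactly the product of those of 1 -
R_1 and 1 - R_2, so R_3 brings in no new factor. -/
lemma ratioThree_facts (hx : ∀ i j, i ≠ j → x i - x j ≠ 0) (hf₁ : factorOne x ≠ 0)
    (hf₂ : factorTwo x ≠ 0) :
    ratioThree (x 0) (x 1) (x 2) (x 3) (x 4) ≠ 0 ∧
    ratioThree (x 0) (x 1) (x 2) (x 3) (x 4) ≠ 1 ∧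
    logClass (ratioThree (x 0) (x 1) (x 2) (x 3) (x 4)) = formThree (pairClass x) ∧
    logClass (1 - ratioThree (x 0) (x 1) (x 2) (x 3) (x 4)) =
      logClass (factorOne x) + logClass (factorTwo x) - denThree (LogSpace F) (pairClass x) := by
  have h01 := hx 0 1 (by decide)
  have h02 := hx 0 2 (by decide)
  have h03 := hx 0 3 (by decide)
  have h04 := hx 0 4 (by decide)
  have h13 := hx 1 3 (by decide)
  have h14 := hx 1 4 (by decide)
  have h23 := hx 2 3 (by decide)
  have h24 := hx 2 4 (by decide)
  have e : 1 - ratioThree (x 0) (x 1) (x 2) (x 3) (x 4) = factorOne x * factorTwo x /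
      ((x 0 - x 2) ^ 3 * (x 0 - x 3) * (x 1 - x 3) * (x 1 - x 4) ^ 2) := by
    rw [ratioThree, factorOne, factorTwo]
    field_simp
    ring
  refine ⟨?_, ?_, ?_, ?_⟩
  · simp [ratioThree, h01, h02, h03, h04, h13, h14, h23, h24]
  · rw [ne_comm, ← sub_ne_zero, e]
    simp [hf₁, hf₂, h02, h03, h13, h14]
  · rw [ratioThree, logClass_neg, logClass_div (by simp [*]) (by simp [*])]
    rw [logClass_mul (by simp [*]) h24, logClass_mul (by simp [*]) (pow_ne_zero 2 h23),
      logClass_mul (pow_ne_zero 3 h01) h04, logClass_mul (by simp [*]) (pow_ne_zero 2 h14),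
      logClass_mul (by simp [*]) h13, logClass_mul (pow_ne_zero 3 h02) h03, logClass_pow h01,
      logClass_pow h23, logClass_pow h02, logClass_pow h14]
    simp only [← natCast_zsmul]
    rfl
  · rw [e, logClass_div (mul_ne_zero hf₁ hf₂) (by simp [*]), logClass_mul hf₁ hf₂]
    rw [logClass_mul (by simp [*]) (pow_ne_zero 2 h14), logClass_mul (by simp [*]) h13,
      logClass_mul (pow_ne_zero 3 h02) h03, logClass_pow h02, logClass_pow h14]
    simp only [← natCast_zsmul]
    rfl

/-- Twice the symbol of one term of the alternating sum. -/
lemma two_smul_symbolTerm [DecidableEq F] (hx : ∀ i j, i ≠ j → x i - x j ≠ 0)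
    (hf₁ : factorOne x ≠ 0) (hf₂ : factorTwo x ≠ 0) :
    (2 : ℤ) • ((11 : ℤ) • nielsenSymb 3 2 (crossRatio (x 0) (x 1) (x 2) (x 3))
      + li5SymbLinear ((15 : ℤ) • bracket (ratioOne (x 0) (x 1) (x 2) (x 3) (x 4))
        - (9 : ℤ) • bracket (ratioTwo (x 0) (x 1) (x 2) (x 3) (x 4))
        + bracket (ratioThree (x 0) (x 1) (x 2) (x 3) (x 4)))) =
      -totalForm (symbolForm F 5) (logClass (factorOne x)) (logClass (factorTwo x))
        (pairClass x) := by
  obtain ⟨hc₀, hc₁, hc, hc'⟩ := crossRatio_facts hx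
  obtain ⟨h₁₀, h₁₁, h₁, h₁'⟩ := ratioOne_facts hx hf₁
  obtain ⟨h₂₀, h₂₁, h₂, h₂'⟩ := ratioTwo_facts hx hf₂
  obtain ⟨h₃₀, h₃₁, h₃, h₃'⟩ := ratioThree_facts hx hf₁ hf₂
  have hb : ∀ z : F, li5SymbLinear (bracket z) = li5Symb z := fun z => by
    simp [li5SymbLinear, bracket]
  have eS := two_smul_nielsenSymb_three_two hc₀ hc₁
  have e₁ := two_smul_li5Symb h₁₀ h₁₁
  have e₂ := two_smul_li5Symb h₂₀ h₂₁
  have e₃ := two_smul_li5Symb h₃₀ h₃₁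
  have hw : ∀ a b c d e : LogSpace F, wedgeForm a b c d e =
    wedgeHom (symbolForm F 5) a b c d e := fun _ _ _ _ _ => rfl
  simp only [hc, hc', h₁, h₁', h₂, h₂', h₃, h₃', hw] at eS e₁ e₂ e₃
  have key : ∀ {S S' R₁ R₁' R₂ R₂' R₃ R₃' : SymbolSpace F 5}, (2 : ℤ) • S = -S' →
      (2 : ℤ) • R₁ = -R₁' → (2 : ℤ) • R₂ = -R₂' → (2 : ℤ) • R₃ = -R₃' →
      (2 : ℤ) • ((11 : ℤ) • S + ((15 : ℤ) • R₁ - (9 : ℤ) • R₂ + R₃)) =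
        -(11 • S' + (15 • R₁' - 9 • R₂' + R₃')) := by
    intro S S' R₁ R₁' R₂ R₂' R₃ R₃' hS h₁ h₂ h₃
    have h : (2 : ℤ) • ((11 : ℤ) • S + ((15 : ℤ) • R₁ - (9 : ℤ) • R₂ + R₃)) =
        (11 : ℤ) • ((2 : ℤ) • S) + ((15 : ℤ) • ((2 : ℤ) • R₁) - (9 : ℤ) • ((2 : ℤ) • R₂) +
          (2 : ℤ) • R₃) := by
      module
    rw [h, hS, h₁, h₂, h₃]
    module
  rw [map_add, map_sub, map_smul, map_smul, hb, hb, hb]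
  exact key eS e₁ e₂ e₃

end Ratios

/-! ### Nondegeneracy at the indeterminates -/

section Indeterminates

lemma factors_indet_ne_zero (σ : Equiv.Perm (Fin 5)) :
    factorOne (fun i => indet (σ i)) ≠ 0 ∧ factorTwo (fun i => indet (σ i)) ≠ 0 := by
  have inj := IsFractionRing.injective (MvPolynomial (Fin 5) ℚ) RatFun5
  -- This sends X_{σ(i)} to i, so for every σ the factors are evaluated at (0, 1, 2, 3, 4), where
  -- they equal -22 and 20.
  let ev : MvPolynomial (Fin 5) ℚ →+* ℚ :=
    MvPolynomial.eval (fun i => ((σ.symm i : ℕ) : ℚ))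
  have hev : (fun i => ev (MvPolynomial.X (σ i))) = fun i : Fin 5 => ((i : ℕ) : ℚ) := by
    funext i
    simp [ev]
  constructor
  · have h : factorOne (fun i => indet (σ i)) = algebraMap (MvPolynomial (Fin 5) ℚ) RatFun5
        (factorOne fun i => MvPolynomial.X (σ i)) := (map_factorOne _ _).symm
    rw [h, Ne, map_eq_zero_iff _ inj]
    intro h0
    have := congrArg ev h0
    rw [map_factorOne, hev, map_zero] at this
    norm_num [factorOne] at this
  · have h : factorTwo (fun i => indet (σ i)) = algebraMap (MvPolynomial (Fin 5) ℚ) RatFun5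
        (factorTwo fun i => MvPolynomial.X (σ i)) := (map_factorTwo _ _).symm
    rw [h, Ne, map_eq_zero_iff _ inj]
    intro h0
    have := congrArg ev h0
    rw [map_factorTwo, hev, map_zero] at this
    norm_num [factorTwo] at this

lemma indet_injective : Function.Injective indet :=
  (IsFractionRing.injective (MvPolynomial (Fin 5) ℚ) RatFun5).comp
    (MvPolynomial.X_injective)

end Indeterminates

end

end NielsenSymbol

open NielsenSymbol in
open scoped Classical in
theorem mainTheorem1 :
    EqModTwoTorsion
      (alt5 (fun x₁ x₂ x₃ x₄ x₅ =>
        (11 : ℤ) • nielsenSymb 3 2 (crossRatio x₁ x₂ x₃ x₄)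
          + li5SymbLinear
              ((15 : ℤ) • bracket (ratioOne x₁ x₂ x₃ x₄ x₅)
                - (9 : ℤ) • bracket (ratioTwo x₁ x₂ x₃ x₄ x₅)
                + bracket (ratioThree x₁ x₂ x₃ x₄ x₅))))
      0 := by
  rw [EqModTwoTorsion, sub_zero, Submodule.mem_torsionBy_iff, alt5, Finset.smul_sum]
  have h := altSum_totalForm_eq_zero (symbolForm RatFun5 5) (pairClass_comm indet)
    (pairClass_self indet) (p := fun σ => logClass (factorOne (indet ∘ σ)))
    (q := fun σ => logClass (factorTwo (indet ∘ σ)))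
    (fun σ => logClass_factorOne_swap (indet ∘ σ))
    (fun σ => logClass_factorOne_doubleSwap (indet ∘ σ))
    (fun σ => logClass_factorTwo_rotation (indet ∘ σ))
  -- The doubled term for σ is minus `totalForm`, so the vanishing sum is negated to match.
  rw [← neg_eq_zero, ← altSum_neg, altSum] at h
  refine (Finset.sum_congr rfl fun σ _ => ?_).trans h
  rw [smul_comm]
  exact congrArg _ (two_smul_symbolTerm (x := indet ∘ σ)
    (fun i j hij => sub_ne_zero.2 ((indet_injective.comp σ.injective).ne hij))
    (factors_indet_ne_zero σ).1 (factors_indet_ne_zero σ).2)
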